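/- For a polynomial $p\in\mathbb{C}[z]$ let $D_p=\mathrm{Spec}\bigl(\mathbb{C}[x,y,z]/(xy-p(z))\bigr)$, regarded as a scheme over $\mathrm{Spec}(\mathbb{C})$. A real structure on a complex variety $X$ is an action of $\mathrm{Gal}(\mathbb{C}/\mathbb{R})$ on the scheme $X$ whose nontrivial element acts by an anti-regular morphism; in other words, it is a morphism of schemes $\rho\colon X\to X$ with $\rho\circ\rho=\mathrm{id}_X$ lying over the automorphism of $\mathrm{Spec}(\mathbb{C})$ induced by complex conjugation. Let $p\in\mathbb{C}[z]$ be a nonconstant polynomial. The following conditions are equivalent: 1. The complex affine surface $D_p$ admits a real structure. 2. There exist $a,\lambda\in\mathbb{C}^*$ and $b\in\mathbb{C}$ such that $\lambda\, p(az+b)\in\mathbb{R}[z]$. 3. There exists $q\in\mathbb{R}[z]$ such that the complex affine surfaces $D_p$ and $D_q$ are isomorphic (over $\mathbb{C}$). -/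

import Mathlib

open Polynomial CategoryTheory AlgebraicGeometry

noncomputable section

namespace Danielewski

/-- The coordinate ring `k[x, y, z] / (x y - p(z))`, where `x, y, z` are `X 0`, `X 1`, `X 2`. -/
abbrev CoordRing (k : Type) [CommRing k] (p : k[X]) : Type :=
  MvPolynomial (Fin 3) k ⧸ (Ideal.span
    {MvPolynomial.X 0 * MvPolynomial.X 1 - Polynomial.aeval (MvPolynomial.X 2) p} :
      Ideal (MvPolynomial (Fin 3) k))

/-- The affine surface `D_p = Spec (k[x, y, z] / (x y - p(z)))`, as a scheme over `Spec k`. -/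
def surface (k : Type) [CommRing k] (p : k[X]) : Over (Spec (CommRingCat.of k)) :=
  Over.mk (Spec.map (CommRingCat.ofHom (algebraMap k (CoordRing k p))))

/-- The morphism `Spec ℂ ⟶ Spec ℂ` induced by complex conjugation. -/
def specConj : Spec (CommRingCat.of ℂ) ⟶ Spec (CommRingCat.of ℂ) :=
  Spec.map (CommRingCat.ofHom (starRingEnd ℂ))

/-- A real structure on a complex scheme `X`: an action of `Gal(ℂ/ℝ)`, a group of order two,
on the scheme `X`, given by the involution `ρ` through which the nontrivial element acts, such
that `ρ` lies over complex conjugation on `Spec ℂ`. -/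
structure RealStructure (X : Over (Spec (CommRingCat.of ℂ))) where
  /-- The action of the nontrivial element of `Gal(ℂ/ℝ)`. -/
  ρ : X.left ⟶ X.left
  involutive : ρ ≫ ρ = 𝟙 X.left
  antiregular : ρ ≫ X.hom = X.hom ≫ specConj

end Danielewski

end

/-! The content is the passage from a real structure to a real polynomial. Composed with conjugation
of coefficients, a real structure becomes a ℂ-isomorphism of `D_p` with the surface of the conjugate
polynomial (`RealStructure.exists_algEquiv`). Two facts then suffice.

(a) If `deg p = deg q ≥ 2` and the surfaces are isomorphic, then `q(z) = l p(az + b)`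
(`exists_comp_eq`). Take `p`, `q` monic, `n = deg p`, and embed the ring of `D_q` in `ℂ(x)[z]`; the
kernel of the locally nilpotent derivation `x ∂/∂z` is the part of `z`-degree 0. Let `φ` be an
isomorphism of the rings. If `φ x` has degree 0, then `φ` is triangular, `x ↦ f(x)`, `z ↦ a z +
g(x)`, and comparing fibres over the `x`-line gives the claim (`exists_dvd_comp`). If `φ y` has
degree 0, exchange `x` and `y`. Otherwise shears `z ↦ z - c x^l`, or the same with `y`, lower the
degree of `φ z` (`exists_leading_relation`). To find the shear, weight `x` and `y` by the degrees of
their images. The associated graded ring of `xy = p(z)` is `ℂ[u^n, v^n, uv]`, with tops `x = u^n`,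
`y = v^n`, `z = uv`, and the top part of the transported derivation is again locally nilpotent and
nonzero. It kills the top part `F` of `φ⁻¹ x`, and `F` vanishes at the leading coefficients of the
images. Its local nilpotency extends to `ℂ[u, v]`, whose kernel is factorially closed, so `F` is a
constant times a power of `v^a' - r u^d'` with `a' = 1` or `d' = 1` and `n ∣ a' + d'`
(`exists_eq_pow_binom`). Hence the leading coefficient of `φ z` is a constant times a power of that
of `φ x` or of `φ y`.

(b) A polynomial affinely equivalent to its conjugate is affinely equivalent to a real one
(`exists_real_of_conj_eq`). After centring, the equivalence is `z ↦ az` up to a factor `l`. Unless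
the polynomial is a monomial, `a` and `l` have modulus 1, and rescaling by their square roots makes
all coefficients real.

Conversely, an affine change of variable and a rescaling of `p` preserve the surface, and
conjugation of coefficients is a real structure when `p` is real. -/

noncomputable section

namespace Danielewski

/-! ### The coordinate ring and its elementary isomorphisms -/

section Generators

variable {k : Type} [CommRing k] (p : k[X])

/-- The coordinate function `x`. -/
def cx : CoordRing k p := Ideal.Quotient.mk _ (MvPolynomial.X 0)

/-- The coordinate function `y`. -/
def cy : CoordRing k p := Ideal.Quotient.mk _ (MvPolynomial.X 1)

/-- The coordinate function `z`. -/
def cz : CoordRing k p := Ideal.Quotient.mk _ (MvPolynomial.X 2)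

theorem cx_mul_cy : cx p * cy p = aeval (cz p) p := by
  have h : aeval (cz p) p = Ideal.Quotient.mkₐ k
      (Ideal.span {MvPolynomial.X 0 * MvPolynomial.X 1 - aeval (MvPolynomial.X 2) p})
      (aeval (MvPolynomial.X 2 : MvPolynomial (Fin 3) k) p) := by
    rw [← Polynomial.aeval_algHom_apply]; rfl
  rw [h]
  refine Ideal.Quotient.eq.mpr (Ideal.subset_span rfl)

theorem adjoin_generators : Algebra.adjoin k {cx p, cy p, cz p} = ⊤ := by
  refine Algebra.eq_top_iff.mpr fun f => ?_
  obtain ⟨g, rfl⟩ := Ideal.Quotient.mk_surjective f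
  induction g using MvPolynomial.induction_on with
  | C c => exact Subalgebra.algebraMap_mem _ c
  | add g h hg hh => rw [map_add]; exact add_mem hg hh
  | mul_X g i hg =>
    rw [map_mul]
    refine mul_mem hg (Algebra.subset_adjoin ?_)
    fin_cases i
    exacts [Or.inl rfl, Or.inr (Or.inl rfl), Or.inr (Or.inr rfl)]

variable {p}

/-- The homomorphism out of the coordinate ring given by a solution of `a b = p(c)`. -/
def lift {B : Type*} [CommRing B] [Algebra k B] (a b c : B) (h : a * b = aeval c p) :
    CoordRing k p →ₐ[k] B :=
  Ideal.Quotient.liftₐ _ (MvPolynomial.aeval ![a, b, c]) (by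
    intro f hf
    have : Ideal.span {MvPolynomial.X 0 * MvPolynomial.X 1 - aeval (MvPolynomial.X 2) p} ≤
        RingHom.ker (MvPolynomial.aeval ![a, b, c] : MvPolynomial (Fin 3) k →ₐ[k] B) := by
      rw [Ideal.span_le, Set.singleton_subset_iff, SetLike.mem_coe, RingHom.mem_ker, map_sub,
        map_mul, ← Polynomial.aeval_algHom_apply]
      simp [h]
    exact this hf)

section lift
variable {B : Type*} [CommRing B] [Algebra k B] (a b c : B) (h : a * b = aeval c p)

@[simp] theorem lift_cx : lift a b c h (cx p) = a := by
  change MvPolynomial.aeval ![a, b, c] (MvPolynomial.X 0) = a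
  simp

@[simp] theorem lift_cy : lift a b c h (cy p) = b := by
  change MvPolynomial.aeval ![a, b, c] (MvPolynomial.X 1) = b
  simp

@[simp] theorem lift_cz : lift a b c h (cz p) = c := by
  change MvPolynomial.aeval ![a, b, c] (MvPolynomial.X 2) = c
  simp

end lift

theorem algHom_ext {B : Type*} [Semiring B] [Algebra k B] {f g : CoordRing k p →ₐ[k] B}
    (hx : f (cx p) = g (cx p)) (hy : f (cy p) = g (cy p)) (hz : f (cz p) = g (cz p)) :
    f = g := by
  refine AlgHom.ext_of_adjoin_eq_top (adjoin_generators p) ?_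
  rintro _ (rfl | rfl | rfl) <;> assumption

variable (p) in
/-- The involution exchanging `x` and `y`. -/
def swap : CoordRing k p ≃ₐ[k] CoordRing k p :=
  AlgEquiv.ofAlgHom (lift (cy p) (cx p) (cz p) (by rw [mul_comm, cx_mul_cy]))
    (lift (cy p) (cx p) (cz p) (by rw [mul_comm, cx_mul_cy]))
    (algHom_ext (by simp) (by simp) (by simp)) (algHom_ext (by simp) (by simp) (by simp))

@[simp] theorem swap_cx : swap p (cx p) = cy p := by simp [swap]
@[simp] theorem swap_cz : swap p (cz p) = cz p := by simp [swap]

end Generators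

/-- Rescaling `p` and an affine change of variable do not change the coordinate ring. -/
def affineEquiv {k : Type} [Field k] {p q : k[X]} {a b l : k} (ha : a ≠ 0) (hl : l ≠ 0)
    (h : q = C l * p.comp (C a * X + C b)) : CoordRing k q ≃ₐ[k] CoordRing k p :=
  AlgEquiv.ofAlgHom
    (lift (cx p) (l • cy p) (a⁻¹ • (cz p - algebraMap k _ b)) (by
      rw [h, map_mul, aeval_C, aeval_comp, mul_smul_comm, cx_mul_cy]
      refine (Algebra.smul_def (A := CoordRing k p) l _).trans ?_
      congr 3
      simp only [map_add, map_mul, aeval_C, aeval_X, ← Algebra.smul_def, smul_smul,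
        mul_inv_cancel₀ ha, one_smul, sub_add_cancel]))
    (lift (cx q) (l⁻¹ • cy q) (a • cz q + algebraMap k _ b) (by
      have hq : aeval (cz q) q = aeval (cz q) (C l * p.comp (C a * X + C b)) :=
        congrArg (aeval (cz q)) h
      rw [mul_smul_comm, cx_mul_cy, hq, map_mul, aeval_C, aeval_comp, ← Algebra.smul_def,
        smul_smul, inv_mul_cancel₀ hl, one_smul]
      simp only [map_add, map_mul, aeval_C, aeval_X, ← Algebra.smul_def]))
    (algHom_ext (by simp) (by simp [smul_smul, hl])
      (by simp only [AlgHom.comp_apply, lift_cz, map_add, map_smul, AlgHom.commutes, smul_smul,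
            mul_inv_cancel₀ ha, one_smul, sub_add_cancel, AlgHom.id_apply]))
    (algHom_ext (by simp) (by simp [smul_smul, hl])
      (by simp only [AlgHom.comp_apply, lift_cz, map_sub, map_smul, AlgHom.commutes, smul_smul,
            inv_mul_cancel₀ ha, one_smul, add_sub_cancel_right, AlgHom.id_apply]))

/-! ### Conjugation and real structures -/

/-- Complex conjugation of the coefficients, as a homomorphism of coordinate rings. -/
def conjHom (p : ℂ[X]) : CoordRing ℂ p →+* CoordRing ℂ (p.map (starRingEnd ℂ)) :=
  Ideal.quotientMap _ (MvPolynomial.map (starRingEnd ℂ)) (by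
    rw [Ideal.span_le, Set.singleton_subset_iff, SetLike.mem_coe, Ideal.mem_comap]
    refine Ideal.subset_span ?_
    rw [Set.mem_singleton_iff, map_sub, map_mul, MvPolynomial.map_X, MvPolynomial.map_X]
    congr 1
    rw [aeval_def, aeval_def, hom_eval₂, eval₂_map, MvPolynomial.map_X]
    congr 1
    ext; simp [MvPolynomial.algebraMap_eq])

section conj
variable (p : ℂ[X])

@[simp] theorem conjHom_cx : conjHom p (cx p) = cx _ := by
  simp [conjHom, cx]

@[simp] theorem conjHom_cy : conjHom p (cy p) = cy _ := by
  simp [conjHom, cy]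

@[simp] theorem conjHom_cz : conjHom p (cz p) = cz _ := by
  simp [conjHom, cz]

@[simp] theorem conjHom_algebraMap (c : ℂ) :
    conjHom p (algebraMap ℂ _ c) = algebraMap ℂ _ (starRingEnd ℂ c) := by
  change conjHom p (Ideal.Quotient.mk _ (MvPolynomial.C c)) = _
  simp only [conjHom, Ideal.quotientMap_mk, MvPolynomial.map_C]
  rfl

end conj

theorem ringHom_ext {p : ℂ[X]} {B : Type*} [Semiring B] {f g : CoordRing ℂ p →+* B}
    (hc : ∀ c : ℂ, f (algebraMap ℂ _ c) = g (algebraMap ℂ _ c))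
    (hx : f (cx p) = g (cx p)) (hy : f (cy p) = g (cy p)) (hz : f (cz p) = g (cz p)) :
    f = g := by
  apply Ideal.Quotient.ringHom_ext
  apply MvPolynomial.ringHom_ext
  · exact hc
  · intro i
    fin_cases i
    exacts [hx, hy, hz]

theorem map_conj_conj (p : ℂ[X]) : (p.map (starRingEnd ℂ)).map (starRingEnd ℂ) = p := by
  rw [Polynomial.map_map]
  convert Polynomial.map_id
  ext; simp

/-- An isomorphism of coordinate rings gives an isomorphism of surfaces. -/
theorem nonempty_surface_iso {p q : ℂ[X]} (e : CoordRing ℂ p ≃ₐ[ℂ] CoordRing ℂ q) :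
    Nonempty (surface ℂ p ≅ surface ℂ q) := by
  refine ⟨Over.isoMk (Scheme.Spec.mapIso e.toRingEquiv.toCommRingCatIso.op.symm) ?_⟩
  change Spec.map (CommRingCat.ofHom (e.symm : CoordRing ℂ q →+* CoordRing ℂ p)) ≫
    Spec.map (CommRingCat.ofHom (algebraMap ℂ (CoordRing ℂ q))) =
    Spec.map (CommRingCat.ofHom (algebraMap ℂ (CoordRing ℂ p)))
  rw [← Spec.map_comp, ← CommRingCat.ofHom_comp]
  congr 2
  ext c
  exact e.symm.commutes c

theorem RealStructure.of_iso {Y Z : Over (Spec (CommRingCat.of ℂ))} (e : Y ≅ Z)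
    (R : RealStructure Z) : Nonempty (RealStructure Y) := by
  refine ⟨⟨e.hom.left ≫ R.ρ ≫ e.inv.left, ?_, ?_⟩⟩
  · have h : e.inv.left ≫ e.hom.left = 𝟙 _ := by rw [← Over.comp_left, e.inv_hom_id]; rfl
    have h' : e.hom.left ≫ e.inv.left = 𝟙 _ := by rw [← Over.comp_left, e.hom_inv_id]; rfl
    simp only [Category.assoc]
    rw [reassoc_of% h, reassoc_of% R.involutive, h']
  · simp only [Category.assoc, Over.w, R.antiregular]
    rw [← Category.assoc, Over.w]

theorem nonempty_realStructure_of_conj_eq {q : ℂ[X]} (hq : q.map (starRingEnd ℂ) = q) :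
    Nonempty (RealStructure (surface ℂ q)) := by
  obtain ⟨f, hc, hx, hy, hz⟩ : ∃ f : CoordRing ℂ q →+* CoordRing ℂ q,
      (∀ c, f (algebraMap ℂ _ c) = algebraMap ℂ _ (starRingEnd ℂ c)) ∧
      f (cx q) = cx q ∧ f (cy q) = cy q ∧ f (cz q) = cz q := by
    have := conjHom_algebraMap q
    have := conjHom_cx q
    have := conjHom_cy q
    have := conjHom_cz q
    -- The codomain depends on the conjugate of `q`, so the map and its values are abstracted before
    -- rewriting by `hq`.
    generalize conjHom q = f at *
    revert f
    rw [hq]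
    exact fun f h1 h2 h3 h4 => ⟨f, h1, h2, h3, h4⟩
  refine ⟨⟨Spec.map (CommRingCat.ofHom f), ?_, ?_⟩⟩
  · change Spec.map (CommRingCat.ofHom f) ≫ Spec.map (CommRingCat.ofHom f) = _
    rw [← Spec.map_comp, ← CommRingCat.ofHom_comp]
    have : f.comp f = RingHom.id _ :=
      ringHom_ext (fun c => by simp [hc]) (by simp [hx]) (by simp [hy]) (by simp [hz])
    rw [this]
    exact Spec.map_id _
  · change Spec.map (CommRingCat.ofHom f) ≫
      Spec.map (CommRingCat.ofHom (algebraMap ℂ (CoordRing ℂ q))) =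
      Spec.map (CommRingCat.ofHom (algebraMap ℂ (CoordRing ℂ q))) ≫
      Spec.map (CommRingCat.ofHom (starRingEnd ℂ))
    rw [← Spec.map_comp, ← CommRingCat.ofHom_comp, ← Spec.map_comp, ← CommRingCat.ofHom_comp]
    congr 2
    ext c
    exact hc c

/-- A real structure yields an isomorphism of `D_p` with its conjugate. -/
theorem RealStructure.exists_algEquiv {p : ℂ[X]} (R : RealStructure (surface ℂ p)) :
    Nonempty (CoordRing ℂ p ≃ₐ[ℂ] CoordRing ℂ (p.map (starRingEnd ℂ))) := by
  obtain ⟨f, hf⟩ : ∃ f : CoordRing ℂ p →+* CoordRing ℂ p,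
      R.ρ = Spec.map (CommRingCat.ofHom f) :=
    ⟨(Spec.preimage (R := CommRingCat.of (CoordRing ℂ p))
      (S := CommRingCat.of (CoordRing ℂ p)) R.ρ).hom, (Spec.map_preimage _).symm⟩
  have hff : f.comp f = RingHom.id _ := by
    have h := R.involutive
    rw [hf] at h
    change Spec.map (CommRingCat.ofHom f) ≫ Spec.map (CommRingCat.ofHom f) =
      𝟙 (Spec (CommRingCat.of (CoordRing ℂ p))) at h
    rw [← Spec.map_comp, ← CommRingCat.ofHom_comp, ← Spec.map_id] at h
    exact congrArg CommRingCat.Hom.hom (Spec.map_injective h)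
  have hfc (c : ℂ) : f (algebraMap ℂ _ c) = algebraMap ℂ _ (starRingEnd ℂ c) := by
    have h := R.antiregular
    rw [hf] at h
    change Spec.map (CommRingCat.ofHom f) ≫
      Spec.map (CommRingCat.ofHom (algebraMap ℂ (CoordRing ℂ p))) =
      Spec.map (CommRingCat.ofHom (algebraMap ℂ (CoordRing ℂ p))) ≫
      Spec.map (CommRingCat.ofHom (starRingEnd ℂ)) at h
    rw [← Spec.map_comp, ← CommRingCat.ofHom_comp, ← Spec.map_comp, ← CommRingCat.ofHom_comp] at h
    exact RingHom.congr_fun (congrArg CommRingCat.Hom.hom (Spec.map_injective h)) c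
  obtain ⟨g, hgc, hx, hy, hz⟩ : ∃ g : CoordRing ℂ (p.map (starRingEnd ℂ)) →+* CoordRing ℂ p,
      (∀ c, g (algebraMap ℂ _ c) = algebraMap ℂ _ (starRingEnd ℂ c)) ∧
      g (cx _) = cx p ∧ g (cy _) = cy p ∧ g (cz _) = cz p := by
    have := conjHom_algebraMap (p.map (starRingEnd ℂ))
    have := conjHom_cx (p.map (starRingEnd ℂ))
    have := conjHom_cy (p.map (starRingEnd ℂ))
    have := conjHom_cz (p.map (starRingEnd ℂ))
    generalize conjHom (p.map (starRingEnd ℂ)) = f at *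
    revert f
    rw [map_conj_conj]
    exact fun f h1 h2 h3 h4 => ⟨f, h1, h2, h3, h4⟩
  have hfg (a) : f (f a) = a := RingHom.congr_fun hff a
  have h1 : g.comp (conjHom p) = RingHom.id _ :=
    ringHom_ext (fun c => by simp [hgc]) (by simp [hx]) (by simp [hy]) (by simp [hz])
  have h2 : (conjHom p).comp g = RingHom.id _ :=
    ringHom_ext (fun c => by simp [hgc]) (by simp [hx]) (by simp [hy]) (by simp [hz])
  have h1' (a) : g (conjHom p a) = a := RingHom.congr_fun h1 a
  have h2' (a) : conjHom p (g a) = a := RingHom.congr_fun h2 a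
  -- Both `f` and `conjHom p` are conjugate-linear, so the composite is ℂ-linear; it is invertible
  -- because `f` is an involution.
  exact ⟨{ toFun := fun a => conjHom p (f a)
           invFun := fun a => f (g a)
           left_inv := fun a => by change f (g (conjHom p (f a))) = a; rw [h1', hfg]
           right_inv := fun a => by change conjHom p (f (f (g a))) = a; rw [hfg, h2']
           map_mul' := fun a b => by simp
           map_add' := fun a b => by simp
           commutes' := fun c => by rw [hfc, conjHom_algebraMap, Complex.conj_conj] }⟩

/-! ### Laurent polynomials, weights and vector fields -/

/-- Laurent polynomials in two variables `u`, `v`. -/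
abbrev Lau : Type := AddMonoidAlgebra ℂ (ℤ × ℤ)

namespace Lau

/-- The monomial `u ^ i * v ^ j`. -/
def mono (m : ℤ × ℤ) : Lau := AddMonoidAlgebra.single m 1

theorem mono_add (m m' : ℤ × ℤ) : mono (m + m') = mono m * mono m' := by
  simp [mono, AddMonoidAlgebra.single_mul_single]

@[simp] theorem mono_zero : mono 0 = 1 := rfl

theorem mono_nsmul (k : ℕ) (m : ℤ × ℤ) : mono (k • m) = mono m ^ k := by
  simp [mono, AddMonoidAlgebra.single_pow]

theorem mono_ne_zero (m : ℤ × ℤ) : mono m ≠ 0 := by simp [mono]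

theorem single_eq_smul (m : ℤ × ℤ) (c : ℂ) : AddMonoidAlgebra.single m c = c • mono m := by
  simp [mono]

@[simp] theorem coeff_mono_mul (m k : ℤ × ℤ) (f : Lau) :
    (mono m * f).coeff k = f.coeff (k - m) := by
  rw [mono, AddMonoidAlgebra.coeff_single_mul_apply, one_mul]
  congr 1
  abel

theorem coeff_mono (m k : ℤ × ℤ) : (mono m).coeff k = if m = k then 1 else 0 := by
  rw [mono, AddMonoidAlgebra.coeff_single, Finsupp.single_apply]

theorem eq_sum (f : Lau) : f = ∑ m ∈ f.coeff.support, f.coeff m • mono m := by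
  conv_lhs => rw [← AddMonoidAlgebra.sum_coeff_single f]
  exact Finset.sum_congr rfl fun m _ => single_eq_smul _ _

/-- The Laurent polynomials all of whose exponents lie in `S`. -/
def supportedOn (S : Set (ℤ × ℤ)) : Submodule ℂ Lau where
  carrier := {f | ∀ m, f.coeff m ≠ 0 → m ∈ S}
  zero_mem' := by simp
  add_mem' := by
    intro f g hf hg m hm
    by_cases h : f.coeff m = 0
    · refine hg m fun h' => hm ?_
      simp [h, h']
    · exact hf m h
  smul_mem' := by
    intro c f hf m hm
    refine hf m fun h => hm ?_
    simp [h]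

variable {S T U : Set (ℤ × ℤ)} {f g : Lau}

theorem coeff_eq_zero (hf : f ∈ supportedOn S) {m : ℤ × ℤ} (hm : m ∉ S) : f.coeff m = 0 := by
  by_contra h
  exact hm (hf m h)

theorem supportedOn_mono (h : S ⊆ T) (hf : f ∈ supportedOn S) : f ∈ supportedOn T :=
  fun m hm => h (hf m hm)

theorem mono_mem {m : ℤ × ℤ} (hm : m ∈ S) : mono m ∈ supportedOn S := by
  intro k hk
  rw [coeff_mono] at hk
  by_cases h : m = k
  · exact h ▸ hm
  · simp [h] at hk

theorem mul_mem (h : ∀ m ∈ S, ∀ k ∈ T, m + k ∈ U) (hf : f ∈ supportedOn S)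
    (hg : g ∈ supportedOn T) : f * g ∈ supportedOn U := by
  rw [eq_sum f, eq_sum g, Finset.sum_mul_sum]
  refine sum_mem fun m hm => sum_mem fun k hk => ?_
  rw [smul_mul_smul_comm, ← mono_add]
  exact Submodule.smul_mem _ _ (mono_mem (h m (hf m (Finsupp.mem_support_iff.mp hm)) k
    (hg k (Finsupp.mem_support_iff.mp hk))))

/-- The component of `w`-weight `s`. -/
def comp (w : ℤ × ℤ →+ ℤ) (s : ℤ) : Lau →ₗ[ℂ] Lau where
  toFun f := .ofCoeff (f.coeff.filter fun m => w m = s)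
  map_add' f g := by
    rw [AddMonoidAlgebra.coeff_add, Finsupp.filter_add, AddMonoidAlgebra.ofCoeff_add]
  map_smul' c f := by
    rw [AddMonoidAlgebra.coeff_smul, Finsupp.filter_smul, AddMonoidAlgebra.ofCoeff_smul,
      RingHom.id_apply]

variable (w : ℤ × ℤ →+ ℤ)

theorem coeff_comp (s : ℤ) (f : Lau) (m : ℤ × ℤ) :
    (comp w s f).coeff m = if w m = s then f.coeff m else 0 :=
  Finsupp.filter_apply _ _ _

theorem comp_mono (s : ℤ) (m : ℤ × ℤ) : comp w s (mono m) = if w m = s then mono m else 0 := by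
  ext k
  rw [coeff_comp, coeff_mono]
  split_ifs with h1 h2 h3 h3 h3 <;> simp_all [coeff_mono]
  rintro rfl
  exact h1 h3

/-- The Laurent polynomials of `w`-weight at most `s`. -/
def weightLE (s : ℤ) : Submodule ℂ Lau := supportedOn {m | w m ≤ s}

variable {w} {s t : ℤ}

theorem weightLE_mul (hf : f ∈ weightLE w s) (hg : g ∈ weightLE w t) :
    f * g ∈ weightLE w (s + t) :=
  mul_mem (fun m hm k hk => by rw [Set.mem_ofPred_eq, map_add]; exact add_le_add hm hk) hf hg

/-- Weight `s + t` is reached only by a term of weight `s` times a term of weight `t`, so top parts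
multiply. -/
theorem comp_mul (hf : f ∈ weightLE w s) (hg : g ∈ weightLE w t) :
    comp w (s + t) (f * g) = comp w s f * comp w t g := by
  conv_rhs => rw [eq_sum f, eq_sum g]
  conv_lhs => rw [eq_sum f, eq_sum g]
  simp only [map_sum, Finset.sum_mul_sum, map_smul, smul_mul_smul_comm, ← mono_add, comp_mono]
  refine Finset.sum_congr rfl fun m hm => Finset.sum_congr rfl fun k hk => ?_
  have h1 : w m ≤ s := hf m (Finsupp.mem_support_iff.mp hm)
  have h2 : w k ≤ t := hg k (Finsupp.mem_support_iff.mp hk)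
  congr 1
  rw [map_add]
  split_ifs with h3 h4 h5 h5 h5 h5
  · rw [mono_add]
  all_goals first | omega | simp

theorem weightLE_one : (1 : Lau) ∈ weightLE w 0 := by
  rw [← mono_zero]
  exact mono_mem (by simp)

theorem comp_one : comp w 0 1 = 1 := by
  rw [← mono_zero, comp_mono, map_zero, if_pos rfl]

theorem weightLE_pow (hf : f ∈ weightLE w s) (n : ℕ) : f ^ n ∈ weightLE w (n * s) := by
  induction n with
  | zero => simpa using weightLE_one
  | succ n ih =>
    rw [pow_succ, Nat.cast_succ, add_mul, one_mul]
    exact weightLE_mul ih hf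

theorem comp_pow (hf : f ∈ weightLE w s) (n : ℕ) : comp w (n * s) (f ^ n) = comp w s f ^ n := by
  induction n with
  | zero => simpa using comp_one
  | succ n ih =>
    rw [pow_succ, pow_succ, Nat.cast_succ, add_mul, one_mul, comp_mul (weightLE_pow hf n) hf, ih]

theorem weightLE_mono (h : s ≤ t) (hf : f ∈ weightLE w s) : f ∈ weightLE w t :=
  supportedOn_mono (fun _ hm => le_trans hm h) hf

theorem comp_eq_zero_of_lt (h : s < t) (hf : f ∈ weightLE w s) : comp w t f = 0 := by
  ext m
  rw [coeff_comp]
  split_ifs with hm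
  · exact coeff_eq_zero hf (by simp [hm, h])
  · rfl

theorem weight_of_comp {m : ℤ × ℤ} (h : (comp w s f).coeff m ≠ 0) : w m = s := by
  rw [coeff_comp] at h
  by_contra h'
  simp [h'] at h

variable (w) in
/-- Two Laurent polynomials, not both zero, have a common top weight. -/
theorem exists_top (P Q : Lau) (h : P ≠ 0 ∨ Q ≠ 0) : ∃ e, P ∈ weightLE w e ∧ Q ∈ weightLE w e ∧
    (comp w e P ≠ 0 ∨ comp w e Q ≠ 0) := by
  classical
  have hne : ((P.coeff.support ∪ Q.coeff.support).image w).Nonempty := by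
    rw [Finset.image_nonempty, Finset.union_nonempty, Finsupp.support_nonempty_iff,
      Finsupp.support_nonempty_iff]
    simpa using h
  refine ⟨((P.coeff.support ∪ Q.coeff.support).image w).max' hne, fun m hm => ?_,
    fun m hm => ?_, ?_⟩
  · change w m ≤ _
    exact Finset.le_max' _ _ (Finset.mem_image_of_mem _ (Finset.mem_union_left _
      (Finsupp.mem_support_iff.mpr hm)))
  · change w m ≤ _
    exact Finset.le_max' _ _ (Finset.mem_image_of_mem _ (Finset.mem_union_right _
      (Finsupp.mem_support_iff.mpr hm)))
  · obtain ⟨m, hm, hm'⟩ := Finset.mem_image.mp (Finset.max'_mem _ hne)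
    rw [← hm']
    rcases Finset.mem_union.mp hm with h | h
    · refine Or.inl fun h0 => Finsupp.mem_support_iff.mp h ?_
      simpa [coeff_comp] using congrArg (fun f : Lau => f.coeff m) h0
    · refine Or.inr fun h0 => Finsupp.mem_support_iff.mp h ?_
      simpa [coeff_comp] using congrArg (fun f : Lau => f.coeff m) h0

/-- The linear map multiplying the monomial of exponent `m` by `l m`. -/
def eulerLinear (l : ℤ × ℤ →+ ℤ) : Lau →ₗ[ℂ] Lau where
  toFun f := .ofCoeff (Finsupp.onFinset f.coeff.support (fun m => l m * f.coeff m)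
    (fun m hm => by
      rw [Finsupp.mem_support_iff]
      exact right_ne_zero_of_mul hm))
  map_add' f g := by
    ext m
    simp [mul_add]
  map_smul' c f := by
    ext m
    simp [mul_left_comm]

theorem coeff_eulerLinear (l : ℤ × ℤ →+ ℤ) (f : Lau) (m : ℤ × ℤ) :
    (eulerLinear l f).coeff m = l m * f.coeff m := rfl

theorem eulerLinear_mono (l : ℤ × ℤ →+ ℤ) (m : ℤ × ℤ) :
    eulerLinear l (mono m) = (l m : ℂ) • mono m := by
  ext k
  rw [coeff_eulerLinear, AddMonoidAlgebra.coeff_smul_apply, coeff_mono]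
  split_ifs with h
  · rw [h, smul_eq_mul]
  · simp

/-- The derivation multiplying the monomial of exponent `m` by `l m`. -/
def euler (l : ℤ × ℤ →+ ℤ) : Derivation ℂ Lau Lau :=
  Derivation.mk' (eulerLinear l) (fun f g => by
    rw [eq_sum f, eq_sum g]
    simp only [map_sum, Finset.sum_mul_sum, map_smul, smul_mul_smul_comm, ← mono_add,
      eulerLinear_mono, smul_eq_mul]
    rw [Finset.sum_comm (s := g.coeff.support),
      ← Finset.sum_add_distrib]
    refine Finset.sum_congr rfl fun m _ => ?_
    rw [← Finset.sum_add_distrib]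
    refine Finset.sum_congr rfl fun k _ => ?_
    simp only [map_add, Int.cast_add, mono_add, Algebra.smul_def, map_add, map_mul]
    ring)

theorem coeff_euler (l : ℤ × ℤ →+ ℤ) (f : Lau) (m : ℤ × ℤ) :
    (euler l f).coeff m = l m * f.coeff m := rfl

theorem euler_mono (l : ℤ × ℤ →+ ℤ) (m : ℤ × ℤ) :
    euler l (mono m) = (l m : ℂ) • mono m := eulerLinear_mono l m

theorem euler_mem (l : ℤ × ℤ →+ ℤ) (hf : f ∈ supportedOn S) : euler l f ∈ supportedOn S :=
  fun m hm => hf m fun h => hm (by rw [coeff_euler, h, mul_zero])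

theorem comp_euler (l : ℤ × ℤ →+ ℤ) (s : ℤ) (f : Lau) :
    comp w s (euler l f) = euler l (comp w s f) := by
  ext m
  simp only [coeff_comp, coeff_euler, mul_ite, mul_zero]

/-- The derivation `P u ∂_u + Q v ∂_v`. -/
def vecField (P Q : Lau) : Derivation ℂ Lau Lau :=
  P • euler (AddMonoidHom.fst ℤ ℤ) + Q • euler (AddMonoidHom.snd ℤ ℤ)

theorem vecField_apply (P Q f : Lau) : vecField P Q f =
    P * euler (AddMonoidHom.fst ℤ ℤ) f + Q * euler (AddMonoidHom.snd ℤ ℤ) f := rfl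

theorem vecField_mono (P Q : Lau) (m : ℤ × ℤ) :
    vecField P Q (mono m) = ((m.1 : ℂ) • P + (m.2 : ℂ) • Q) * mono m := by
  rw [vecField_apply, euler_mono, euler_mono, add_mul, mul_smul_comm, mul_smul_comm,
    smul_mul_assoc, smul_mul_assoc]
  rfl

theorem vecField_weightLE {P Q : Lau} {e : ℤ} (hP : P ∈ weightLE w e) (hQ : Q ∈ weightLE w e)
    (hf : f ∈ weightLE w s) : vecField P Q f ∈ weightLE w (e + s) :=
  add_mem (weightLE_mul hP (euler_mem _ hf)) (weightLE_mul hQ (euler_mem _ hf))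

theorem comp_vecField {P Q : Lau} {e : ℤ} (hP : P ∈ weightLE w e) (hQ : Q ∈ weightLE w e)
    (hf : f ∈ weightLE w s) :
    comp w (e + s) (vecField P Q f) = vecField (comp w e P) (comp w e Q) (comp w s f) := by
  rw [vecField_apply, map_add, comp_mul hP (euler_mem _ hf), comp_mul hQ (euler_mem _ hf),
    comp_euler, comp_euler, vecField_apply]

/-- When an iterate kills `f`, the same iterate of the top field kills the top part of `f`: this is
how local nilpotency passes to the graded ring. -/
theorem iterate_vecField_weightLE {P Q : Lau} {e : ℤ} (hP : P ∈ weightLE w e)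
    (hQ : Q ∈ weightLE w e) (hf : f ∈ weightLE w s) (n : ℕ) :
    (vecField P Q)^[n] f ∈ weightLE w (n * e + s) ∧
    comp w (n * e + s) ((vecField P Q)^[n] f) =
      (vecField (comp w e P) (comp w e Q))^[n] (comp w s f) := by
  induction n with
  | zero => simpa using hf
  | succ n ih =>
    have h : ((n + 1 : ℕ) * e + s : ℤ) = e + (n * e + s) := by push_cast; ring
    rw [Function.iterate_succ_apply', Function.iterate_succ_apply', h, ← ih.2]
    exact ⟨vecField_weightLE hP hQ ih.1, comp_vecField hP hQ ih.1⟩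

end Lau

/-! ### Locally nilpotent derivations -/

section LocallyNilpotent

variable {B : Type*} [CommRing B] [Algebra ℂ B] (D : Derivation ℂ B B) {f g : B}

theorem iterate_map_zero (n : ℕ) : D^[n] 0 = 0 := Function.iterate_fixed (map_zero D) n

theorem iterate_map_add (n : ℕ) (f g : B) : D^[n] (f + g) = D^[n] f + D^[n] g := by
  induction n generalizing f g with
  | zero => rfl
  | succ n ih => simp only [Function.iterate_succ_apply, map_add, ih]

theorem iterate_eq_zero_of_le {m n : ℕ} (h : m ≤ n) (hf : D^[m] f = 0) : D^[n] f = 0 := by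
  rw [← Nat.sub_add_cancel h, Function.iterate_add_apply, hf, iterate_map_zero]

theorem iterate_mul_of_eq_zero (hf : D f = 0) (n : ℕ) : D^[n] (f * g) = f * D^[n] g := by
  induction n generalizing g with
  | zero => rfl
  | succ n ih =>
    rw [Function.iterate_succ_apply, Function.iterate_succ_apply, D.leibniz, hf, smul_zero,
      add_zero, smul_eq_mul, ih]

/-- Only one term of the Leibniz formula survives. In a domain of characteristic 0 it is nonzero
when both factors are, so the order of nilpotency is additive on products. -/
theorem iterate_mul {m n : ℕ} (hf : D^[m + 1] f = 0) (hg : D^[n + 1] g = 0) :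
    D^[m + n] (f * g) = (m + n).choose m * (D^[m] f * D^[n] g) := by
  induction h : m + n generalizing m n f g with
  | zero =>
    obtain ⟨rfl, rfl⟩ := Nat.add_eq_zero_iff.mp h
    simp
  | succ N ih =>
    obtain _ | m := m
    · obtain rfl : n = N + 1 := by omega
      rw [iterate_mul_of_eq_zero D hf]
      simp
    obtain _ | n := n
    · obtain rfl : m = N := by omega
      rw [mul_comm f, iterate_mul_of_eq_zero D hg]
      simp [mul_comm]
    rw [Function.iterate_succ_apply, D.leibniz, iterate_map_add, smul_eq_mul, smul_eq_mul,
      mul_comm g, ih (m := m + 1) (n := n) hf hg (by omega),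
      ih (m := m) (n := n + 1) hf hg (by omega), Nat.choose_succ_succ, ← Function.iterate_succ_apply,
      ← Function.iterate_succ_apply]
    push_cast
    ring

theorem iterate_mul_eq_zero {m n : ℕ} (hf : D^[m + 1] f = 0) (hg : D^[n + 1] g = 0) :
    D^[m + n + 1] (f * g) = 0 := by
  rw [Function.iterate_succ_apply', iterate_mul D hf hg, D.leibniz, D.leibniz,
    ← Function.iterate_succ_apply' (f := D), ← Function.iterate_succ_apply' (f := D), hf, hg,
    D.map_natCast]
  simp

/-- The elements on which a derivation is nilpotent. -/
def nilSubalgebra : Subalgebra ℂ B where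
  carrier := {f | ∃ n, D^[n] f = 0}
  mul_mem' := by
    rintro f g ⟨m, hm⟩ ⟨n, hn⟩
    exact ⟨_, iterate_mul_eq_zero D (iterate_eq_zero_of_le D m.le_succ hm)
      (iterate_eq_zero_of_le D n.le_succ hn)⟩
  add_mem' := by
    rintro f g ⟨m, hm⟩ ⟨n, hn⟩
    refine ⟨max m n, ?_⟩
    rw [iterate_map_add, iterate_eq_zero_of_le D (le_max_left m n) hm,
      iterate_eq_zero_of_le D (le_max_right m n) hn, add_zero]
  algebraMap_mem' c := ⟨1, D.map_algebraMap c⟩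

theorem apply_mem_nilSubalgebra (hf : f ∈ nilSubalgebra D) : D f ∈ nilSubalgebra D := by
  obtain ⟨n, hn⟩ := hf
  refine ⟨n, ?_⟩
  rw [← Function.iterate_succ_apply]
  exact iterate_eq_zero_of_le D n.le_succ hn

/-- The order of nilpotency, minus one. -/
def nilOrd (f : B) : ℕ := sInf {n | D^[n + 1] f = 0}

variable {D}

theorem iterate_nilOrd_succ (hf : f ∈ nilSubalgebra D) : D^[nilOrd D f + 1] f = 0 := by
  obtain ⟨n, hn⟩ := hf
  exact Nat.sInf_mem (s := {n | D^[n + 1] f = 0}) ⟨n, iterate_eq_zero_of_le D n.le_succ hn⟩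

theorem iterate_nilOrd (h0 : f ≠ 0) : D^[nilOrd D f] f ≠ 0 := by
  intro h
  obtain hn | ⟨n, hn⟩ : nilOrd D f = 0 ∨ ∃ n, nilOrd D f = n + 1 := by
    cases nilOrd D f <;> simp
  · rw [hn] at h
    exact h0 h
  · rw [hn] at h
    have : nilOrd D f ≤ n := Nat.sInf_le (s := {n | D^[n + 1] f = 0}) h
    omega

theorem nilOrd_eq {n : ℕ} (h : D^[n] f ≠ 0) (h' : D^[n + 1] f = 0) : nilOrd D f = n := by
  refine le_antisymm (Nat.sInf_le h') ?_
  by_contra! hlt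
  exact h (iterate_eq_zero_of_le D hlt (iterate_nilOrd_succ ⟨_, h'⟩))

theorem nilOrd_eq_zero_of_apply_eq_zero (h : D f = 0) : nilOrd D f = 0 :=
  Nat.le_zero.mp (Nat.sInf_le h)

theorem apply_eq_zero_of_nilOrd (hf : f ∈ nilSubalgebra D) (h : nilOrd D f = 0) : D f = 0 := by
  simpa [h] using iterate_nilOrd_succ hf

theorem nilOrd_apply (hf : f ∈ nilSubalgebra D) (h : D f ≠ 0) :
    nilOrd D f = nilOrd D (D f) + 1 := by
  have hD := apply_mem_nilSubalgebra D hf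
  apply nilOrd_eq
  · rw [Function.iterate_succ_apply]
    exact iterate_nilOrd h
  · rw [Function.iterate_succ_apply]
    exact iterate_nilOrd_succ hD

variable [IsDomain B]

theorem nilOrd_mul (hf : f ∈ nilSubalgebra D) (hg : g ∈ nilSubalgebra D) (hf0 : f ≠ 0)
    (hg0 : g ≠ 0) : nilOrd D (f * g) = nilOrd D f + nilOrd D g := by
  have hc : CharZero B := charZero_of_injective_algebraMap (algebraMap ℂ B).injective
  apply nilOrd_eq
  · rw [iterate_mul D (iterate_nilOrd_succ hf) (iterate_nilOrd_succ hg)]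
    refine mul_ne_zero ?_ (mul_ne_zero (iterate_nilOrd hf0) (iterate_nilOrd hg0))
    exact_mod_cast (Nat.choose_pos (Nat.le_add_right _ _)).ne'
  · exact iterate_mul_eq_zero D (iterate_nilOrd_succ hf) (iterate_nilOrd_succ hg)

theorem nilOrd_pow (hf : f ∈ nilSubalgebra D) (hf0 : f ≠ 0) (n : ℕ) :
    nilOrd D (f ^ n) = n * nilOrd D f := by
  induction n with
  | zero => simp [nilOrd_eq_zero_of_apply_eq_zero (D.map_one_eq_zero)]
  | succ n ih => rw [pow_succ, nilOrd_mul (pow_mem hf n) hf (pow_ne_zero n hf0) hf0, ih]; ring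

/-- The kernel of a locally nilpotent derivation is factorially closed. -/
theorem apply_eq_zero_of_mul (hf : f ∈ nilSubalgebra D) (hg : g ∈ nilSubalgebra D) (hf0 : f ≠ 0)
    (hg0 : g ≠ 0) (h : D (f * g) = 0) : D f = 0 := by
  refine apply_eq_zero_of_nilOrd hf ?_
  have := nilOrd_mul hf hg hf0 hg0
  rw [nilOrd_eq_zero_of_apply_eq_zero h] at this
  omega

/-- Nilpotency of a derivation on the `n`-th powers of all iterated derivatives of an element. -/
theorem mem_nilSubalgebra_of_iterate_pow {n : ℕ} (hn : n ≠ 0)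
    (h : ∀ k, (D^[k] f) ^ n ∈ nilSubalgebra D) : f ∈ nilSubalgebra D := by
  have hc : CharZero B := charZero_of_injective_algebraMap (algebraMap ℂ B).injective
  induction hN : nilOrd D (f ^ n) using Nat.strong_induction_on generalizing f with
  | _ N ih =>
  subst hN
  by_cases hf0 : f = 0
  · rw [hf0]; exact zero_mem _
  by_cases hDf : D f = 0
  · exact ⟨1, hDf⟩
  have hpow : D (f ^ n) = n * (f ^ (n - 1) * D f) := by
    rw [D.leibniz_pow, nsmul_eq_mul, smul_eq_mul]
  have hne : D (f ^ n) ≠ 0 := by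
    rw [hpow]
    exact mul_ne_zero (Nat.cast_ne_zero.mpr hn) (mul_ne_zero (pow_ne_zero _ hf0) hDf)
  have h0 : f ^ n ∈ nilSubalgebra D := h 0
  have h1 : (D f) ^ n ∈ nilSubalgebra D := h 1
  -- The `n`-th power of `D (f ^ n) = n f ^ (n - 1) D f` involves only `f ^ n` and `(D f) ^ n`,
  -- which are known to be nilpotent. With `N` the order of `f ^ n` it gives `n (N - 1) = (n - 1) N
  -- + ord ((D f) ^ n)`, so `(D f) ^ n` has order `N - n < N` and induction applies to `D f`.
  have key : nilOrd D (D (f ^ n) ^ n) =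
      nilOrd D ((algebraMap ℂ B (n ^ n)) * ((f ^ n) ^ (n - 1) * (D f) ^ n)) := by
    congr 1
    rw [hpow, mul_pow, mul_pow, ← pow_mul, ← pow_mul, mul_comm n (n - 1)]
    simp
  have hcn : (algebraMap ℂ B (n ^ n)) ≠ 0 := by
    simp [hn]
  rw [nilOrd_pow (apply_mem_nilSubalgebra D h0) hne, nilOrd_mul (Subalgebra.algebraMap_mem _ _)
    (mul_mem (pow_mem h0 _) h1) hcn (mul_ne_zero (pow_ne_zero _ (pow_ne_zero _ hf0))
    (pow_ne_zero _ hDf)), nilOrd_mul (pow_mem h0 _) h1 (pow_ne_zero _ (pow_ne_zero _ hf0))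
    (pow_ne_zero _ hDf), nilOrd_pow h0 (pow_ne_zero _ hf0),
    nilOrd_eq_zero_of_apply_eq_zero (D.map_algebraMap _)] at key
  have hord := nilOrd_apply h0 hne
  obtain ⟨m, hm⟩ := ih (nilOrd D ((D f) ^ n)) (by
    rw [hord] at key ⊢
    obtain ⟨n, rfl⟩ := Nat.exists_eq_succ_of_ne_zero hn
    simp only [Nat.succ_eq_add_one, Nat.add_sub_cancel] at key
    nlinarith) (fun k => h (k + 1)) rfl
  exact ⟨m + 1, hm⟩

end LocallyNilpotent

/-! ### Weighted homogeneous polynomials -/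

namespace Lau

/-- The exponents `(i, j)` with `i, j ≥ 0` and `i - j ≡ r` modulo `n`. -/
def cone (n : ℕ) (r : ℤ) : Set (ℤ × ℤ) := {m | 0 ≤ m.1 ∧ 0 ≤ m.2 ∧ (n : ℤ) ∣ m.1 - m.2 - r}

/-- The exponents `(i, j)` with `i, j ≥ 0`. -/
def quadrant : Set (ℤ × ℤ) := {m | 0 ≤ m.1 ∧ 0 ≤ m.2}

theorem pow_mem_cone {n : ℕ} {r : ℤ} {f : Lau} (hf : f ∈ supportedOn (cone n r)) (k : ℕ) :
    f ^ k ∈ supportedOn (cone n (k * r)) := by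
  induction k with
  | zero =>
    rw [pow_zero, ← mono_zero]
    exact mono_mem (by simp [cone])
  | succ k ih =>
    rw [pow_succ]
    refine mul_mem ?_ ih hf
    rintro ⟨i, j⟩ ⟨h1, h2, h3⟩ ⟨i', j'⟩ ⟨h1', h2', h3'⟩
    refine ⟨add_nonneg h1 h1', add_nonneg h2 h2', ?_⟩
    have e : i + i' - (j + j') - ((k + 1 : ℕ) : ℤ) * r = i - j - k * r + (i' - j' - r) := by
      push_cast
      ring
    exact (congrArg ((n : ℤ) ∣ ·) e).mpr (dvd_add h3 h3')

/-- The binomials `v ^ a - r u ^ d`. -/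
def binom (a d : ℕ) (r : ℂ) : Lau := mono (0, a) - r • mono (d, 0)

theorem binom_mem (a d : ℕ) (r : ℂ) : binom a d r ∈ supportedOn quadrant :=
  sub_mem (mono_mem (by simp [quadrant])) (Submodule.smul_mem _ _ (mono_mem (by simp [quadrant])))

/-- In the single variable `u ^ (-d) v ^ a`, factoring weighted homogeneous polynomials becomes
splitting over ℂ. -/
theorem binom_eq (a d : ℕ) (r : ℂ) :
    binom a d r = mono (d, 0) * aeval (mono (-(d : ℤ), (a : ℤ))) (X - C r) := by
  rw [map_sub, aeval_X, aeval_C, mul_sub, ← mono_add, mul_comm _ (algebraMap _ _ _),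
    ← Algebra.smul_def, binom]
  simp

theorem nsmul_mk (k : ℕ) (i j : ℤ) : k • ((i, j) : ℤ × ℤ) = (k * i, k * j) := by
  rw [Prod.smul_mk, nsmul_eq_mul, nsmul_eq_mul]

theorem nsmul_inj {m : ℤ × ℤ} (hm : m ≠ 0) {j k : ℕ} : j • m = k • m ↔ j = k := by
  refine ⟨fun h => ?_, fun h => h ▸ rfl⟩
  obtain ⟨i, l⟩ := m
  rw [nsmul_mk, nsmul_mk, Prod.mk.injEq] at h
  by_cases hi : i = 0
  · have hl : l ≠ 0 := by rintro rfl; exact hm (by rw [hi]; rfl)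
    exact_mod_cast mul_right_cancel₀ hl h.2
  · exact_mod_cast mul_right_cancel₀ hi h.1

theorem coeff_aeval_mono {m : ℤ × ℤ} (hm : m ≠ 0) (f : ℂ[X]) (k : ℕ) :
    (aeval (mono m) f).coeff (k • m) = f.coeff k := by
  induction f using Polynomial.induction_on' with
  | add p q hp hq => rw [map_add, AddMonoidAlgebra.coeff_add, Finsupp.add_apply, hp, hq, coeff_add]
  | monomial j c =>
    rw [aeval_monomial, ← Algebra.smul_def, ← mono_nsmul, AddMonoidAlgebra.coeff_smul_apply,
      coeff_mono, coeff_monomial]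
    simp only [nsmul_inj hm, smul_eq_mul, mul_ite, mul_one, mul_zero]

/-- A nonzero weighted homogeneous polynomial is a product of a monomial and binomials. -/
theorem exists_factorization {a d : ℕ} (ha : 0 < a) (hd : 0 < d) {W : ℤ} {F : Lau} (h0 : F ≠ 0)
    (hF : F ∈ supportedOn quadrant) (hW : ∀ m, F.coeff m ≠ 0 → a * m.1 + d * m.2 = W) :
    ∃ (a' d' s t : ℕ) (c : ℂ) (R : Multiset ℂ), 0 < a' ∧ 0 < d' ∧ a * d' = d * a' ∧ c ≠ 0 ∧
      0 ∉ R ∧ F = c • (mono (s, t) * (R.map (binom a' d')).prod) := by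
  obtain ⟨g, a', d', hg, hcop, rfl, rfl⟩ := Nat.exists_coprime' (m := a) (n := d)
    (Nat.gcd_pos_of_pos_left _ ha)
  have ha' : 0 < a' := Nat.pos_of_mul_pos_right ha
  have hd' : 0 < d' := Nat.pos_of_mul_pos_right hd
  -- Exponents of equal weight differ by multiples of the primitive vector `(-d', a')`; from the one
  -- with least `v`-exponent all multiples are nonnegative.
  obtain ⟨m0, hm0, hmin⟩ := F.coeff.support.exists_min_image Prod.snd
    (Finsupp.support_nonempty_iff.mpr (by simpa using h0))
  have hk (m : ℤ × ℤ) (hm : m ∈ F.coeff.support) : ∃ k : ℕ, m = m0 + k • (-(d' : ℤ), (a' : ℤ)) := by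
    have h1 := hW m (Finsupp.mem_support_iff.mp hm)
    have h2 := hW m0 (Finsupp.mem_support_iff.mp hm0)
    push_cast at h1 h2
    have h3 : (g : ℤ) * (a' * (m.1 - m0.1)) = g * (d' * (m0.2 - m.2)) := by linarith
    have h4 := mul_left_cancel₀ (by exact_mod_cast hg.ne') h3
    have h5 : (a' : ℤ) ∣ m.2 - m0.2 := by
      refine IsCoprime.dvd_of_dvd_mul_left (y := (d' : ℤ))
        (Nat.isCoprime_iff_coprime.mpr hcop) ⟨m0.1 - m.1, by linarith⟩
    obtain ⟨k, hk⟩ := h5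
    have hk0 : 0 ≤ k := by
      have := hmin m hm
      have h6 : 0 ≤ a' * k := by omega
      exact nonneg_of_mul_nonneg_right h6 (by exact_mod_cast ha')
    lift k to ℕ using hk0
    refine ⟨k, Prod.ext ?_ ?_⟩
    · have : (a' : ℤ) * (m.1 - m0.1) = a' * (-(d' * k)) := by
        rw [h4, ← neg_sub m.2, hk]
        ring
      have := mul_left_cancel₀ (by exact_mod_cast ha'.ne') this
      rw [nsmul_mk, Prod.fst_add]
      linarith
    · rw [nsmul_mk, Prod.snd_add]
      linarith
  choose! k hk using hk
  let f : ℂ[X] := ∑ m ∈ F.coeff.support, monomial (k m) (F.coeff m)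
  have hFf : F = mono m0 * aeval (mono (-(d' : ℤ), (a' : ℤ))) f := by
    conv_lhs => rw [eq_sum F]
    rw [map_sum, Finset.mul_sum]
    refine Finset.sum_congr rfl fun m hm => ?_
    rw [aeval_monomial, ← Algebra.smul_def, mul_smul_comm, ← mono_nsmul, ← mono_add, ← hk m hm]
  have hne : (-(d' : ℤ), (a' : ℤ)) ≠ 0 := by
    simp [ha'.ne']
  have hcoeff (j : ℕ) : f.coeff j = F.coeff (m0 + j • (-(d' : ℤ), (a' : ℤ))) := by
    rw [← coeff_aeval_mono hne, hFf, coeff_mono_mul]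
    simp
  have hf0 : f ≠ 0 := by
    rintro h
    rw [h, map_zero, mul_zero] at hFf
    exact h0 hFf
  -- The power of `u` left over is the `u`-exponent of the monomial for the leading term of `f`,
  -- hence nonnegative.
  obtain ⟨s, hs⟩ : ∃ s : ℕ, (s : ℤ) = m0.1 - f.natDegree * d' := by
    have h := hF (m0 + f.natDegree • (-(d' : ℤ), (a' : ℤ))) (by
      rw [← hcoeff]
      exact leadingCoeff_ne_zero.mpr hf0)
    refine ⟨(m0.1 - f.natDegree * d').toNat, Int.toNat_of_nonneg ?_⟩
    have := h.1
    rw [nsmul_mk, Prod.fst_add] at this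
    linarith
  obtain ⟨t, ht⟩ := Int.eq_ofNat_of_zero_le (hF m0 (Finsupp.mem_support_iff.mp hm0)).2
  have hsplit := IsAlgClosed.splits f
  refine ⟨a', d', s, t, f.leadingCoeff, f.roots, ha', hd', by ring,
    leadingCoeff_ne_zero.mpr hf0, ?_, ?_⟩
  · rw [mem_roots hf0, IsRoot, ← coeff_zero_eq_eval_zero, hcoeff]
    simpa using hm0
  · conv_lhs => rw [hFf, hsplit.eq_prod_roots]
    have : (f.roots.map (binom a' d')) = f.roots.map fun r => mono (d', 0) *
        aeval (mono (-(d' : ℤ), (a' : ℤ))) (X - C r) := Multiset.map_congr rfl fun r _ => binom_eq a' d' r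
    rw [this, Multiset.prod_map_mul, Multiset.map_const', Multiset.prod_replicate,
      ← hsplit.natDegree_eq_card_roots, map_mul, aeval_C, map_multiset_prod, Multiset.map_map,
      ← mono_nsmul, Algebra.smul_def, ← mul_assoc (mono (s, t)), ← mono_add]
    have hm : ((s, t) : ℤ × ℤ) + f.natDegree • ((d', 0) : ℤ × ℤ) = m0 := by
      rw [nsmul_mk]
      refine Prod.ext ?_ ?_ <;> simp [hs, ht]
    rw [hm]
    simp only [Function.comp_def]
    ring

end Lau

/-- The order of `D f` is one less than that of `f`, and it is at least that of its divisor `g`. -/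
theorem nilOrd_lt {B : Type*} [CommRing B] [Algebra ℂ B] [IsDomain B] {D : Derivation ℂ B B}
    {f g E : B} {k : ℕ} (hk : k ≠ 0) (hf : f ∈ nilSubalgebra D) (hg : g ∈ nilSubalgebra D)
    (hE : E ∈ nilSubalgebra D) (h : D f = g ^ k * E) (h0 : D f ≠ 0) :
    nilOrd D g < nilOrd D f := by
  have hg0 : g ≠ 0 := by
    rintro rfl
    exact h0 (by rw [h, zero_pow hk, zero_mul])
  have hE0 : E ≠ 0 := by
    rintro rfl
    exact h0 (by rw [h, mul_zero])
  rw [nilOrd_apply hf h0, h, nilOrd_mul (pow_mem hg k) hE (pow_ne_zero k hg0) hE0,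
    nilOrd_pow hg hg0]
  have := Nat.le_mul_of_pos_left (nilOrd D g) (Nat.pos_of_ne_zero hk)
  omega

/-! ### Locally nilpotent fields on `ℂ[u ^ n, v ^ n, u v]` -/

namespace Lau

/-- A vector field preserving the invariant polynomials `ℂ[u ^ n, v ^ n, u v]`, and locally
nilpotent on them. -/
structure IsNilField (n : ℕ) (P Q : Lau) : Prop where
  left_mem : mono (n, 0) * P ∈ supportedOn (cone n 0)
  right_mem : mono (0, n) * Q ∈ supportedOn (cone n 0)
  add_mem : mono (1, 1) * (P + Q) ∈ supportedOn (cone n 0)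
  nil_left : mono (n, 0) ∈ nilSubalgebra (vecField P Q)
  nil_right : mono (0, n) ∈ nilSubalgebra (vecField P Q)
  nil_mul : mono (1, 1) ∈ nilSubalgebra (vecField P Q)

namespace IsNilField

variable {n : ℕ} {P Q : Lau}

/-- The condition on `u ^ n P` only bounds the `u`-exponent below by `-n`. But `Q` has no negative
`u`-exponents, so a term of `P` with exponent below `-1` would survive in `P + Q`, against
`add_mem`. -/
theorem coeff_left (h : IsNilField n P Q) {m : ℤ × ℤ} (hm : P.coeff m ≠ 0) :
    -1 ≤ m.1 ∧ 0 ≤ m.2 ∧ (n : ℤ) ∣ m.1 - m.2 := by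
  have h1 := h.left_mem (m + ((n : ℤ), 0)) (by rwa [coeff_mono_mul, add_sub_cancel_right])
  obtain ⟨i, j⟩ := m
  simp only [cone, Prod.mk_add_mk, Set.mem_ofPred_eq, add_zero, sub_zero] at h1
  refine ⟨?_, h1.2.1, ?_⟩
  · by_contra! hlt
    have hQ : Q.coeff (i, j) = 0 := by
      by_contra hQ
      have := h.right_mem ((i, j) + (0, (n : ℤ))) (by rwa [coeff_mono_mul, add_sub_cancel_right])
      simp only [cone, Prod.mk_add_mk, Set.mem_ofPred_eq, sub_zero] at this hlt
      omega
    have := h.add_mem ((i, j) + (1, 1)) (by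
      rw [coeff_mono_mul, add_sub_cancel_right, AddMonoidAlgebra.coeff_add, Finsupp.add_apply, hQ,
        add_zero]
      exact hm)
    simp only [cone, Prod.mk_add_mk, Set.mem_ofPred_eq, sub_zero] at this hlt
    omega
  · have := dvd_sub h1.2.2 (dvd_refl (n : ℤ))
    rwa [show i + n - j - n = i - j by ring] at this

theorem coeff_right (h : IsNilField n P Q) {m : ℤ × ℤ} (hm : Q.coeff m ≠ 0) :
    0 ≤ m.1 ∧ -1 ≤ m.2 ∧ (n : ℤ) ∣ m.1 - m.2 := by
  have h1 := h.right_mem (m + (0, (n : ℤ))) (by rwa [coeff_mono_mul, add_sub_cancel_right])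
  obtain ⟨i, j⟩ := m
  simp only [cone, Prod.mk_add_mk, Set.mem_ofPred_eq, add_zero, sub_zero] at h1
  refine ⟨h1.1, ?_, ?_⟩
  · by_contra! hlt
    have hP : P.coeff (i, j) = 0 := by
      by_contra hP
      have := h.left_mem ((i, j) + ((n : ℤ), 0)) (by rwa [coeff_mono_mul, add_sub_cancel_right])
      simp only [cone, Prod.mk_add_mk, Set.mem_ofPred_eq, sub_zero] at this hlt
      omega
    have := h.add_mem ((i, j) + (1, 1)) (by
      rw [coeff_mono_mul, add_sub_cancel_right, AddMonoidAlgebra.coeff_add, Finsupp.add_apply, hP,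
        zero_add]
      exact hm)
    simp only [cone, Prod.mk_add_mk, Set.mem_ofPred_eq, sub_zero] at this hlt
    omega
  · have := dvd_add h1.2.2 (dvd_refl (n : ℤ))
    rwa [show i - (j + n) + n = i - j by ring] at this

/-- The simple pole of `P` in `u` does no harm, since `u ∂_u` kills the terms without `u`; likewise
for `Q` and `v`. -/
theorem apply_mem_cone (h : IsNilField n P Q) {r : ℤ} {f : Lau} (hf : f ∈ supportedOn (cone n r)) :
    vecField P Q f ∈ supportedOn (cone n r) := by
  rw [vecField_apply]
  refine AddMemClass.add_mem ?_ ?_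
  · refine mul_mem (S := {m | -1 ≤ m.1 ∧ 0 ≤ m.2 ∧ (n : ℤ) ∣ m.1 - m.2})
      (T := {m | m ∈ cone n r ∧ 1 ≤ m.1}) ?_ (fun m hm => h.coeff_left hm) (fun m hm => ?_)
    · rintro ⟨i, j⟩ ⟨h1, h2, h3⟩ ⟨k, l⟩ ⟨⟨h4, h5, h6⟩, h7⟩
      simp only [cone, Prod.mk_add_mk, Set.mem_ofPred_eq] at *
      refine ⟨by omega, by omega, ?_⟩
      have := dvd_add h3 h6
      rwa [show i - j + (k - l - r) = i + k - (j + l) - r by ring] at this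
    · rw [coeff_euler] at hm
      have h1 := hf m (right_ne_zero_of_mul hm)
      have h2 : m.1 ≠ 0 := fun h0 => hm (by simp [h0])
      exact ⟨h1, by have := h1.1; omega⟩
  · refine mul_mem (S := {m | 0 ≤ m.1 ∧ -1 ≤ m.2 ∧ (n : ℤ) ∣ m.1 - m.2})
      (T := {m | m ∈ cone n r ∧ 1 ≤ m.2}) ?_ (fun m hm => h.coeff_right hm) (fun m hm => ?_)
    · rintro ⟨i, j⟩ ⟨h1, h2, h3⟩ ⟨k, l⟩ ⟨⟨h4, h5, h6⟩, h7⟩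
      simp only [cone, Prod.mk_add_mk, Set.mem_ofPred_eq] at *
      refine ⟨by omega, by omega, ?_⟩
      have := dvd_add h3 h6
      rwa [show i - j + (k - l - r) = i + k - (j + l) - r by ring] at this
    · rw [coeff_euler] at hm
      have h1 := hf m (right_ne_zero_of_mul hm)
      have h2 : m.2 ≠ 0 := fun h0 => hm (by simp [h0])
      exact ⟨h1, by have := h1.2.1; omega⟩

theorem nil_of_mem_cone (h : IsNilField n P Q) {f : Lau} (hf : f ∈ supportedOn (cone n 0)) :
    f ∈ nilSubalgebra (vecField P Q) := by
  rw [eq_sum f]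
  refine sum_mem fun m hm => Subalgebra.smul_mem _ ?_ _
  obtain ⟨h1, h2, k, hk⟩ := hf m (Finsupp.mem_support_iff.mp hm)
  obtain ⟨i, j⟩ := m
  simp only [sub_zero] at h1 h2 hk
  lift i to ℕ using h1
  lift j to ℕ using h2
  rcases le_total 0 k with hk0 | hk0
  · lift k to ℕ using hk0
    have : ((i, j) : ℤ × ℤ) = k • ((n : ℤ), (0 : ℤ)) + j • ((1 : ℤ), (1 : ℤ)) := by
      rw [nsmul_mk, nsmul_mk]
      refine Prod.ext ?_ ?_ <;> simp
      linarith
    rw [this, mono_add, mono_nsmul, mono_nsmul]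
    exact MulMemClass.mul_mem (_root_.pow_mem h.nil_left _) (_root_.pow_mem h.nil_mul _)
  · obtain ⟨k, rfl⟩ := Int.exists_eq_neg_ofNat hk0
    have : ((i, j) : ℤ × ℤ) = k • ((0 : ℤ), (n : ℤ)) + i • ((1 : ℤ), (1 : ℤ)) := by
      rw [nsmul_mk, nsmul_mk]
      refine Prod.ext ?_ ?_ <;> simp
      linarith
    rw [this, mono_add, mono_nsmul, mono_nsmul]
    exact MulMemClass.mul_mem (_root_.pow_mem h.nil_right _) (_root_.pow_mem h.nil_mul _)

/-- The `n`-th powers of `f` and of all its derivatives are invariant, so nilpotency on the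
invariants extends to each residue class, and by sums to all of `ℂ[u, v]`. -/
theorem nil_of_mem_cone' (h : IsNilField n P Q) (hn : n ≠ 0) {r : ℤ} {f : Lau} (hf : f ∈ supportedOn (cone n r)) :
    f ∈ nilSubalgebra (vecField P Q) := by
  refine mem_nilSubalgebra_of_iterate_pow hn fun k => h.nil_of_mem_cone ?_
  have h1 : (vecField P Q)^[k] f ∈ supportedOn (cone n r) := by
    induction k with
    | zero => exact hf
    | succ k ih => rw [Function.iterate_succ_apply']; exact h.apply_mem_cone ih
  refine supportedOn_mono ?_ (pow_mem_cone h1 n)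
  rintro m ⟨h2, h3, h4⟩
  refine ⟨h2, h3, ?_⟩
  have := dvd_add h4 (dvd_mul_right (n : ℤ) r)
  simpa using this

theorem nil_of_mem_quadrant (h : IsNilField n P Q) (hn : n ≠ 0) {f : Lau} (hf : f ∈ supportedOn quadrant) :
    f ∈ nilSubalgebra (vecField P Q) := by
  rw [eq_sum f]
  refine sum_mem fun m hm => Subalgebra.smul_mem _ ?_ _
  obtain ⟨h1, h2⟩ := hf m (Finsupp.mem_support_iff.mp hm)
  exact h.nil_of_mem_cone' hn (r := m.1 - m.2) (mono_mem ⟨h1, h2, by simp⟩)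

end IsNilField

end Lau

namespace Lau

theorem coeff_binom_pow (a d K : ℕ) (ha : 0 < a) (r : ℂ) (k : ℕ) :
    (binom a d r ^ K).coeff ((K * d - k * d, k * a) : ℤ × ℤ) = ((X - C r) ^ K).coeff k := by
  have hne : ((-(d : ℤ), (a : ℤ)) : ℤ × ℤ) ≠ 0 := by
    simp [ha.ne']
  rw [← coeff_aeval_mono hne, binom_eq, mul_pow, ← map_pow, ← mono_nsmul, coeff_mono_mul]
  congr 1
  rw [nsmul_mk, nsmul_mk]
  refine Prod.ext ?_ ?_
  · simp only [Prod.fst_sub]; ring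
  · simp

/-- All the exponents `((K - k) d, k a)` occur in the power, and the difference of coordinates
changes by `a + d` from one to the next. -/
theorem dvd_of_pow_binom_mem {n a d K : ℕ} (ha : 0 < a) (hK : K ≠ 0) {c r : ℂ} (hc : c ≠ 0)
    (hr : r ≠ 0) (h : c • binom a d r ^ K ∈ supportedOn (cone n 0)) : n ∣ a + d := by
  have key (k : ℕ) (hk : k ≤ K) : (n : ℤ) ∣ K * d - k * d - k * a - 0 := by
    refine (h (K * d - k * d, k * a) ?_).2.2
    rw [AddMonoidAlgebra.coeff_smul_apply, coeff_binom_pow a d K ha, sub_eq_add_neg, ← C_neg,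
      coeff_X_add_C_pow]
    refine mul_ne_zero hc (mul_ne_zero (pow_ne_zero _ (neg_ne_zero.mpr hr)) ?_)
    exact_mod_cast (Nat.choose_pos hk).ne'
  have h1 := dvd_sub (key (K - 1) (by omega)) (key K le_rfl)
  obtain ⟨K, rfl⟩ := Nat.exists_eq_succ_of_ne_zero hK
  rw [← Int.natCast_dvd_natCast]
  have e : ((a + d : ℕ) : ℤ) = ((K.succ : ℕ) : ℤ) * d - ((K.succ - 1 : ℕ) : ℤ) * d -
      ((K.succ - 1 : ℕ) : ℤ) * a - 0 - (((K.succ : ℕ) : ℤ) * d - ((K.succ : ℕ) : ℤ) * d -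
      ((K.succ : ℕ) : ℤ) * a - 0) := by
    rw [Nat.succ_sub_one]
    push_cast
    ring
  rw [e]
  exact h1

namespace IsNilField

variable {n : ℕ} {P Q : Lau}

theorem left_eq_zero {s : ℕ} (hs : s ≠ 0)
    (h0 : vecField P Q (mono (s, 0)) = 0) : P = 0 := by
  rw [vecField_mono] at h0
  have := (mul_eq_zero.mp h0).resolve_right (mono_ne_zero _)
  simpa [hs] using this

theorem right_eq_zero {s : ℕ} (hs : s ≠ 0)
    (h0 : vecField P Q (mono (0, s)) = 0) : Q = 0 := by
  rw [vecField_mono] at h0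
  have := (mul_eq_zero.mp h0).resolve_right (mono_ne_zero _)
  simpa [hs] using this

theorem vecField_binom {a d : ℕ} {r : ℂ} (h0 : vecField P Q (binom a d r) = 0) :
    (a : ℂ) • (Q * mono (0, a)) = r • (d : ℂ) • (P * mono (d, 0)) := by
  rw [binom, map_sub, Derivation.map_smul, vecField_mono, vecField_mono, sub_eq_zero] at h0
  simpa [smul_mul_assoc] using h0

theorem left_eq_zero_iff {a d : ℕ} {r : ℂ} (ha : a ≠ 0) (hd : d ≠ 0) (hr : r ≠ 0)
    (h0 : vecField P Q (binom a d r) = 0) : P = 0 ↔ Q = 0 := by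
  have := vecField_binom h0
  constructor
  · rintro rfl
    simpa [ha, mono_ne_zero] using this
  · rintro rfl
    simpa [hd, hr, mono_ne_zero] using this.symm

/-- The exponents of a binomial killed by a nonzero locally nilpotent vector field. -/
theorem eq_one_of_binom (h : IsNilField n P Q) (hn : n ≠ 0) (hP : P ≠ 0) {a d : ℕ} {r : ℂ} (ha : a ≠ 0) (hd : d ≠ 0)
    (hr : r ≠ 0) (h0 : vecField P Q (binom a d r) = 0) : a = 1 ∨ d = 1 := by
  by_contra! hne
  have hQ : Q ≠ 0 := fun hQ => hP ((left_eq_zero_iff ha hd hr h0).mpr hQ)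
  have hrel := vecField_binom h0
  have hu : mono (1, 0) ∈ nilSubalgebra (vecField P Q) :=
    h.nil_of_mem_quadrant hn (mono_mem (by simp [quadrant]))
  have hv : mono (0, 1) ∈ nilSubalgebra (vecField P Q) :=
    h.nil_of_mem_quadrant hn (mono_mem (by simp [quadrant]))
  have hDu : vecField P Q (mono (1, 0)) = mono (1, 0) * P := by
    rw [vecField_mono]; simp [mul_comm]
  have hDv : vecField P Q (mono (0, 1)) = mono (0, 1) * Q := by
    rw [vecField_mono]; simp [mul_comm]
  have hcoeff (m : ℤ × ℤ) : a * Q.coeff (m - (0, (a : ℤ))) = r * (d * P.coeff (m - ((d : ℤ), 0))) := by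
    have := congrArg (fun f : Lau => f.coeff m) hrel
    simpa [mul_comm _ (mono _)] using this
  -- By `hrel`, `v ^ (a - 1)` divides `D u = u P` and `u ^ (d - 1)` divides `D v = v Q` in `ℂ[u,
  -- v]`. For `a, d ≥ 2` each of `u`, `v` would have smaller order than the other.
  have h1 : nilOrd (vecField P Q) (mono (0, 1)) < nilOrd (vecField P Q) (mono (1, 0)) := by
    refine nilOrd_lt (k := a - 1) (E := mono (1, -((a - 1 : ℕ) : ℤ)) * P) (by omega) hu hv
      (h.nil_of_mem_quadrant hn ?_) ?_ ?_
    · intro m hm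
      rw [coeff_mono_mul] at hm
      have h2 := h.coeff_left hm
      have h3 := hcoeff (m - (1, -((a - 1 : ℕ) : ℤ)) + ((d : ℤ), 0))
      rw [add_sub_cancel_right] at h3
      have h4 := h.coeff_right (right_ne_zero_of_mul (h3.trans_ne (mul_ne_zero hr
        (mul_ne_zero (Nat.cast_ne_zero.mpr hd) hm))))
      obtain ⟨i, j⟩ := m
      simp only [Prod.mk_sub_mk, Prod.mk_add_mk, quadrant, Set.mem_ofPred_eq] at h2 h4 ⊢
      omega
    · rw [hDu, ← mono_nsmul, ← mul_assoc, ← mono_add, nsmul_mk]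
      simp
    · rw [hDu]
      exact mul_ne_zero (mono_ne_zero _) hP
  have h2 : nilOrd (vecField P Q) (mono (1, 0)) < nilOrd (vecField P Q) (mono (0, 1)) := by
    refine nilOrd_lt (k := d - 1) (E := mono (-((d - 1 : ℕ) : ℤ), 1) * Q) (by omega) hv hu
      (h.nil_of_mem_quadrant hn ?_) ?_ ?_
    · intro m hm
      rw [coeff_mono_mul] at hm
      have h2 := h.coeff_right hm
      have h3 := hcoeff (m - (-((d - 1 : ℕ) : ℤ), 1) + (0, (a : ℤ)))
      rw [add_sub_cancel_right] at h3
      have h4 := h.coeff_left (right_ne_zero_of_mul (right_ne_zero_of_mul (h3.symm.trans_ne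
        (mul_ne_zero (Nat.cast_ne_zero.mpr ha) hm))))
      obtain ⟨i, j⟩ := m
      simp only [Prod.mk_sub_mk, Prod.mk_add_mk, quadrant, Set.mem_ofPred_eq] at h2 h4 ⊢
      omega
    · rw [hDv, ← mono_nsmul, ← mul_assoc, ← mono_add, nsmul_mk]
      simp
    · rw [hDv]
      exact mul_ne_zero (mono_ne_zero _) hQ
  omega

/-- A homogeneous invariant in the kernel of a locally nilpotent vector field is either a
monomial or a power of a binomial, linear in one of the variables. -/
theorem exists_eq_pow_binom (h : IsNilField n P Q) (hn : n ≠ 0) (hPQ : P ≠ 0 ∨ Q ≠ 0) {a d : ℕ} (ha : 0 < a)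
    (hd : 0 < d) {W : ℤ} {F : Lau} (hF : F ∈ supportedOn (cone n 0))
    (hW : ∀ m, F.coeff m ≠ 0 → a * m.1 + d * m.2 = W) (hmono : ∀ (c : ℂ) (m), F ≠ c • mono m)
    (hD : vecField P Q F = 0) :
    ∃ (a' d' K : ℕ) (c r : ℂ), a * d' = d * a' ∧ (a' = 1 ∨ d' = 1) ∧ n ∣ a' + d' ∧ c ≠ 0 ∧
      r ≠ 0 ∧ F = c • binom a' d' r ^ K := by
  have hF0 : F ≠ 0 := fun h0 => hmono 0 0 (by rw [h0, zero_smul])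
  obtain ⟨a', d', s, t, c, R, ha', hd', had, hc, hR0, hFR⟩ := exists_factorization ha hd hF0
    (supportedOn_mono (fun m hm => ⟨hm.1, hm.2.1⟩) hF) hW
  have hne (r : ℂ) (hr : r ∈ R) : r ≠ 0 := fun h0 => hR0 (h0 ▸ hr)
  have hmonoN (m : ℤ × ℤ) (hm : m ∈ quadrant) := h.nil_of_mem_quadrant hn (mono_mem hm)
  have hbinN (r : ℂ) := h.nil_of_mem_quadrant hn (binom_mem a' d' r)
  have hker (f g : Lau) (hfg : F = f * g) (hf : f ∈ nilSubalgebra (vecField P Q))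
      (hg : g ∈ nilSubalgebra (vecField P Q)) : vecField P Q f = 0 := by
    refine apply_eq_zero_of_mul hf hg ?_ ?_ (hfg ▸ hD)
    · rintro rfl; exact hF0 (by rw [hfg, zero_mul])
    · rintro rfl; exact hF0 (by rw [hfg, mul_zero])
  have hprodN (S : Multiset ℂ) : (S.map (binom a' d')).prod ∈ nilSubalgebra (vecField P Q) := by
    refine multiset_prod_mem _ fun f hf => ?_
    obtain ⟨r, -, rfl⟩ := Multiset.mem_map.mp hf
    exact hbinN r
  -- The kernel is factorially closed, so every factor of `F` is killed.
  have hkr (r : ℂ) (hr : r ∈ R) : vecField P Q (binom a' d' r) = 0 := by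
    obtain ⟨S, rfl⟩ := Multiset.exists_cons_of_mem hr
    rw [Multiset.map_cons, Multiset.prod_cons] at hFR
    refine hker _ (c • (mono ((s : ℤ), (t : ℤ)) * (S.map (binom a' d')).prod)) ?_ (hbinN r)
      (Subalgebra.smul_mem _ (MulMemClass.mul_mem (hmonoN _ (by simp [quadrant])) (hprodN S)) _)
    rw [hFR, mul_smul_comm]
    congr 1
    ring
  obtain ⟨r, hr⟩ : ∃ r, r ∈ R := by
    refine Multiset.exists_mem_of_ne_zero fun h0 => hmono c (s, t) ?_
    rw [hFR, h0, Multiset.map_zero, Multiset.prod_zero, mul_one]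
  have hiff := left_eq_zero_iff ha'.ne' hd'.ne' (hne r hr) (hkr r hr)
  have hP : P ≠ 0 := fun h0 => hPQ.elim (· h0) (· (hiff.mp h0))
  have hQ : Q ≠ 0 := fun h0 => hP (hiff.mpr h0)
  -- With a power of `u` in the kernel `P` would vanish, and with a power of `v` so would `Q`; a
  -- binomial in the kernel excludes both.
  have hs : s = 0 := by
    by_contra hs
    refine hP (left_eq_zero hs (hker _ (c • (mono (0, (t : ℤ)) * (R.map (binom a' d')).prod)) ?_
      (hmonoN _ (by simp [quadrant])) (Subalgebra.smul_mem _
        (MulMemClass.mul_mem (hmonoN _ (by simp [quadrant])) (hprodN R)) _)))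
    rw [hFR, mul_smul_comm, ← mul_assoc, ← mono_add]
    simp
  have ht : t = 0 := by
    by_contra ht
    refine hQ (right_eq_zero ht (hker _ (c • (mono ((s : ℤ), 0) * (R.map (binom a' d')).prod)) ?_
      (hmonoN _ (by simp [quadrant])) (Subalgebra.smul_mem _
        (MulMemClass.mul_mem (hmonoN _ (by simp [quadrant])) (hprodN R)) _)))
    rw [hFR, mul_smul_comm, ← mul_assoc, ← mono_add]
    simp
  -- Binomials with different roots differ by a nonzero multiple of `u ^ d'`, which is not in the
  -- kernel.
  have hall (r' : ℂ) (hr' : r' ∈ R) : r' = r := by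
    by_contra hne'
    have h1 : binom a' d' r - binom a' d' r' = (r' - r) • mono (d', 0) := by
      rw [binom, binom, sub_smul]; ring
    have h2 : vecField P Q ((r' - r) • mono (d', 0)) = 0 := by
      rw [← h1, map_sub, hkr r hr, hkr r' hr', sub_zero]
    rw [Derivation.map_smul] at h2
    exact hP (left_eq_zero hd'.ne'
      ((smul_eq_zero.mp h2).resolve_left (sub_ne_zero.mpr hne')))
  have hFK : F = c • binom a' d' r ^ R.card := by
    conv_lhs => rw [hFR, Multiset.eq_replicate_card.mpr hall, hs, ht, Multiset.map_replicate,
      Multiset.prod_replicate]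
    simp [show ((0, 0) : ℤ × ℤ) = 0 from rfl]
  refine ⟨a', d', R.card, c, r, had, h.eq_one_of_binom hn hP ha'.ne' hd'.ne' (hne r hr) (hkr r hr),
    dvd_of_pow_binom_mem ha' ?_ hc (hne r hr) (hFK ▸ hF), hc, hne r hr, hFK⟩
  rw [Ne, Multiset.card_eq_zero]
  rintro rfl
  simp at hr

end IsNilField

end Lau

/-! ### Normal form in the coordinate ring -/

section NormalForm

variable (p : ℂ[X])

/-- The monomials `x ^ m z ^ j` and `y ^ (-m) z ^ j`, which form a basis of the coordinate ring. -/
def basisElt (k : ℤ × ℕ) : CoordRing ℂ p := cx p ^ k.1.toNat * cy p ^ (-k.1).toNat * cz p ^ k.2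

variable {p}

/-- Trading one `x y` for `p(z)` lowers the exponent of `x`. -/
theorem monomial_mem_span (a b j : ℕ) :
    cx p ^ a * cy p ^ b * cz p ^ j ∈ Submodule.span ℂ (Set.range (basisElt p)) := by
  induction a generalizing b j with
  | zero => exact Submodule.subset_span ⟨(-b, j), by simp [basisElt]⟩
  | succ a ih =>
    obtain _ | b := b
    · exact Submodule.subset_span ⟨((a + 1 : ℕ), j), by
        rw [basisElt, Int.toNat_natCast, show (-((a + 1 : ℕ) : ℤ)).toNat = 0 by omega]⟩
    · have : cx p ^ (a + 1) * cy p ^ (b + 1) * cz p ^ j =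
          ∑ i ∈ Finset.range (p.natDegree + 1), p.coeff i • (cx p ^ a * cy p ^ b * cz p ^ (i + j)) := by
        calc _ = cx p ^ a * cy p ^ b * cz p ^ j * (cx p * cy p) := by ring
          _ = _ := by
            rw [(cx_mul_cy p).trans (aeval_eq_sum_range _), Finset.mul_sum]
            refine Finset.sum_congr rfl fun i _ => ?_
            rw [mul_smul_comm]
            congr 1
            ring
      rw [this]
      exact Submodule.sum_mem _ fun i _ => Submodule.smul_mem _ _ (ih b (i + j))

theorem span_basisElt : Submodule.span ℂ (Set.range (basisElt p)) = ⊤ := by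
  rw [Submodule.eq_top_iff']
  intro f
  have key : ∀ g ∈ Submodule.span ℂ (Set.range (basisElt p)),
      f * g ∈ Submodule.span ℂ (Set.range (basisElt p)) := by
    have hf : f ∈ Algebra.adjoin ℂ {cx p, cy p, cz p} := by rw [adjoin_generators]; trivial
    induction hf using Algebra.adjoin_induction with
    | mem f hf =>
      intro g hg
      induction hg using Submodule.span_induction with
      | mem g hg =>
        obtain ⟨k, rfl⟩ := hg
        rcases hf with rfl | rfl | rfl
        · convert monomial_mem_span (p := p) (k.1.toNat + 1) (-k.1).toNat k.2 using 1
          rw [basisElt]; ring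
        · convert monomial_mem_span (p := p) k.1.toNat ((-k.1).toNat + 1) k.2 using 1
          rw [basisElt]; ring
        · convert monomial_mem_span (p := p) k.1.toNat (-k.1).toNat (k.2 + 1) using 1
          rw [basisElt]; ring
      | zero => rw [mul_zero]; exact zero_mem _
      | add g h _ _ hg hh => rw [mul_add]; exact add_mem hg hh
      | smul c g _ hg => rw [mul_smul_comm]; exact Submodule.smul_mem _ c hg
    | algebraMap c =>
      intro g hg
      rw [← Algebra.smul_def]
      exact Submodule.smul_mem _ c hg
    | add f f' _ _ h h' => intro g hg; rw [add_mul]; exact add_mem (h g hg) (h' g hg)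
    | mul f f' _ _ h h' => intro g hg; rw [mul_assoc]; exact h _ (h' g hg)
  have h1 : (1 : CoordRing ℂ p) ∈ Submodule.span ℂ (Set.range (basisElt p)) :=
    Submodule.subset_span ⟨(0, 0), by simp [basisElt]⟩
  simpa using key 1 h1

theorem exists_eq_sum (f : CoordRing ℂ p) :
    ∃ c : ℤ × ℕ →₀ ℂ, f = ∑ k ∈ c.support, c k • basisElt p k := by
  have hf : f ∈ Submodule.span ℂ (Set.range (basisElt p)) := by rw [span_basisElt]; trivial
  obtain ⟨c, hc⟩ := Finsupp.mem_span_range_iff_exists_finsupp.mp hf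
  exact ⟨c, hc.symm⟩

end NormalForm

/-! ### The weight filtration and its graded ring -/

open Lau

/-- The exponent of the top monomial of the basis element of index `k`. -/
def topExp (n : ℕ) (k : ℤ × ℕ) : ℤ × ℤ := (k.2 + n * k.1.toNat, k.2 + n * (-k.1).toNat)

/-- The difference of coordinates is `n` times the first index. Distinct basis elements have
distinct top monomials, so tops never cancel; linear independence and the shape of the graded ring
both follow. -/
theorem topExp_injective {n : ℕ} (hn : n ≠ 0) : Function.Injective (topExp n) := by
  rintro ⟨m, j⟩ ⟨m', j'⟩ h
  simp only [topExp, Prod.mk.injEq] at h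
  have h1 (m : ℤ) : ((m.toNat : ℤ) - (-m).toNat) = m := Int.toNat_sub_toNat_neg m
  have h2 : (n : ℤ) * m = n * m' := by
    rw [← h1 m, ← h1 m']
    linear_combination h.1 - h.2
  obtain rfl := mul_left_cancel₀ (by exact_mod_cast hn) h2
  have := h.1
  simp only [add_left_inj, Nat.cast_inj] at this
  rw [this]

theorem topExp_mem_cone (n : ℕ) (k : ℤ × ℕ) : topExp n k ∈ cone n 0 := by
  refine ⟨by simp only [topExp]; positivity, by simp only [topExp]; positivity,
    k.1.toNat - (-k.1).toNat, ?_⟩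
  simp only [topExp]
  ring

/-- The weight of exponents with `u`, `v` of weight `a`, `d`. -/
def wt (a d : ℕ) : ℤ × ℤ →+ ℤ where
  toFun m := a * m.1 + d * m.2
  map_zero' := by simp
  map_add' m m' := by simp only [Prod.fst_add, Prod.snd_add]; ring

theorem wt_apply (a d : ℕ) (m : ℤ × ℤ) : wt a d m = a * m.1 + d * m.2 := rfl

section toLau

variable (p : ℂ[X])

/-- The embedding `x ↦ u ^ n`, `z ↦ u v` of the coordinate ring into Laurent polynomials. -/
def toLau : CoordRing ℂ p →ₐ[ℂ] Lau :=
  lift (mono (p.natDegree, 0)) (mono (-(p.natDegree : ℤ), 0) * aeval (mono (1, 1)) p)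
    (mono (1, 1)) (by
      rw [← mul_assoc, ← mono_add]
      simp [show ((0, 0) : ℤ × ℤ) = 0 from rfl])

@[simp] theorem toLau_cx : toLau p (cx p) = mono (p.natDegree, 0) := lift_cx _ _ _ _

@[simp] theorem toLau_cy :
    toLau p (cy p) = mono (-(p.natDegree : ℤ), 0) * aeval (mono (1, 1)) p := lift_cy _ _ _ _

@[simp] theorem toLau_cz : toLau p (cz p) = mono (1, 1) := lift_cz _ _ _ _

variable {p} {a d : ℕ}

theorem mono_weight (m : ℤ × ℤ) {w : ℤ × ℤ →+ ℤ} : mono m ∈ weightLE w (w m) ∧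
    comp w (w m) (mono m) = mono m :=
  ⟨mono_mem (show w m ≤ w m from le_rfl), by rw [comp_mono, if_pos rfl]⟩

theorem toLau_cx_weight (w : ℤ × ℤ →+ ℤ) : toLau p (cx p) ∈ weightLE w (w (p.natDegree, 0)) ∧
    comp w (w (p.natDegree, 0)) (toLau p (cx p)) = mono (p.natDegree, 0) := by
  rw [toLau_cx]; exact mono_weight _

theorem toLau_cz_weight (w : ℤ × ℤ →+ ℤ) : toLau p (cz p) ∈ weightLE w (w (1, 1)) ∧
    comp w (w (1, 1)) (toLau p (cz p)) = mono (1, 1) := by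
  rw [toLau_cz]; exact mono_weight _

theorem aeval_weight (hp : p.Monic) (had : 0 < a + d) :
    aeval (mono (1, 1)) p ∈ weightLE (wt a d) (wt a d (p.natDegree, p.natDegree)) ∧
    comp (wt a d) (wt a d (p.natDegree, p.natDegree)) (aeval (mono (1, 1)) p) =
      mono (p.natDegree, p.natDegree) := by
  have h (i : ℕ) : mono (1, 1) ^ i = mono (i, i) := by
    rw [← mono_nsmul, nsmul_mk, mul_one]
  have hw (i : ℕ) : wt a d (i, i) = (a + d) * i := by rw [wt_apply]; ring
  have had' : (0 : ℤ) < a + d := by exact_mod_cast had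
  rw [aeval_eq_sum_range]
  simp only [h]
  constructor
  · refine sum_mem fun i hi => Submodule.smul_mem _ _ (mono_mem ?_)
    rw [Set.mem_ofPred_eq, hw, hw]
    have := Finset.mem_range_succ_iff.mp hi
    gcongr
  · rw [map_sum, Finset.sum_range_succ, Finset.sum_eq_zero]
    · rw [zero_add, map_smul, hp.coeff_natDegree, one_smul, comp_mono, if_pos rfl]
    · intro i hi
      rw [map_smul, comp_mono, if_neg, smul_zero]
      rw [hw, hw]
      have := Finset.mem_range.mp hi
      intro h
      have := mul_left_cancel₀ had'.ne' h
      omega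

theorem toLau_cy_weight (hp : p.Monic) (had : 0 < a + d) :
    toLau p (cy p) ∈ weightLE (wt a d) (wt a d (0, p.natDegree)) ∧
    comp (wt a d) (wt a d (0, p.natDegree)) (toLau p (cy p)) = mono (0, p.natDegree) := by
  have h1 := mono_weight (-(p.natDegree : ℤ), 0) (w := wt a d)
  have h2 := aeval_weight hp had
  have h : ((0, p.natDegree) : ℤ × ℤ) = (-(p.natDegree : ℤ), (0 : ℤ)) +
      ((p.natDegree : ℤ), (p.natDegree : ℤ)) := by
    simp
  rw [toLau_cy, h, map_add]
  refine ⟨weightLE_mul h1.1 h2.1, ?_⟩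
  rw [comp_mul h1.1 h2.1, h1.2, h2.2, ← mono_add]

theorem toLau_basisElt_weight (hp : p.Monic) (had : 0 < a + d) (k : ℤ × ℕ) :
    toLau p (basisElt p k) ∈ weightLE (wt a d) (wt a d (topExp p.natDegree k)) ∧
    comp (wt a d) (wt a d (topExp p.natDegree k)) (toLau p (basisElt p k)) =
      mono (topExp p.natDegree k) := by
  have hx := mono_weight (p.natDegree, 0) (w := wt a d)
  have hy := toLau_cy_weight hp had
  have hz := mono_weight (1, 1) (w := wt a d)
  have h : topExp p.natDegree k = k.1.toNat • ((p.natDegree : ℤ), (0 : ℤ)) +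
      (-k.1).toNat • ((0 : ℤ), (p.natDegree : ℤ)) + k.2 • ((1 : ℤ), (1 : ℤ)) := by
    rw [nsmul_mk, nsmul_mk, nsmul_mk, topExp]
    refine Prod.ext ?_ ?_
    · simp only [Prod.fst_add]; ring
    · simp only [Prod.snd_add]; ring
  rw [basisElt, map_mul, map_mul, map_pow, map_pow, map_pow, toLau_cx, toLau_cz, h, map_add,
    map_add, map_nsmul, map_nsmul, map_nsmul, nsmul_eq_mul, nsmul_eq_mul, nsmul_eq_mul]
  have h1 := weightLE_pow hx.1 k.1.toNat
  have h2 := weightLE_pow hy.1 (-k.1).toNat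
  have h3 := weightLE_pow hz.1 k.2
  refine ⟨weightLE_mul (weightLE_mul h1 h2) h3, ?_⟩
  rw [comp_mul (weightLE_mul h1 h2) h3, comp_mul h1 h2, comp_pow hx.1, comp_pow hy.1,
    comp_pow hz.1, hx.2, hy.2, hz.2, mono_add, mono_add, mono_nsmul, mono_nsmul, mono_nsmul]

variable (c : ℤ × ℕ →₀ ℂ) {s : ℤ}

theorem toLau_sum_weight (hp : p.Monic) (had : 0 < a + d)
    (hs : ∀ k ∈ c.support, wt a d (topExp p.natDegree k) ≤ s) :
    toLau p (∑ k ∈ c.support, c k • basisElt p k) ∈ weightLE (wt a d) s ∧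
    comp (wt a d) s (toLau p (∑ k ∈ c.support, c k • basisElt p k)) =
      ∑ k ∈ c.support with wt a d (topExp p.natDegree k) = s,
        c k • mono (topExp p.natDegree k) := by
  rw [map_sum]
  constructor
  · refine sum_mem fun k hk => ?_
    rw [map_smul]
    exact Submodule.smul_mem _ _ (weightLE_mono (hs k hk) (toLau_basisElt_weight hp had k).1)
  · rw [map_sum, Finset.sum_filter]
    refine Finset.sum_congr rfl fun k hk => ?_
    rw [map_smul, map_smul]
    have h := toLau_basisElt_weight hp had k
    split_ifs with hks
    · rw [← hks, h.2]
    · rw [comp_eq_zero_of_lt (lt_of_le_of_ne (hs k hk) hks) h.1, smul_zero]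

theorem coeff_sum_topExp {n : ℕ} (hn : n ≠ 0) (q : ℤ × ℕ → Prop) [DecidablePred q] (k : ℤ × ℕ) :
    (∑ k ∈ c.support with q k, c k • mono (topExp n k) : Lau).coeff (topExp n k) =
      if q k then c k else 0 := by
  rw [AddMonoidAlgebra.coeff_sum, Finsupp.finsetSum_apply, Finset.sum_filter]
  simp only [AddMonoidAlgebra.coeff_smul_apply, coeff_mono, (topExp_injective hn).eq_iff]
  rw [Finset.sum_eq_single k]
  · simp
  · intro k' _ hk'
    simp [hk']
  · intro hk
    simp [Finsupp.notMem_support_iff.mp hk]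

theorem weight_le_of_toLau (hp : p.Monic) (hn : p.natDegree ≠ 0) (had : 0 < a + d)
    (h : toLau p (∑ k ∈ c.support, c k • basisElt p k) ∈ weightLE (wt a d) s) {k : ℤ × ℕ}
    (hk : k ∈ c.support) : wt a d (topExp p.natDegree k) ≤ s := by
  obtain ⟨k0, hk0, hmax⟩ := c.support.exists_max_image
    (fun k => wt a d (topExp p.natDegree k)) ⟨k, hk⟩
  refine (hmax k hk).trans ?_
  by_contra! hlt
  have h1 := (toLau_sum_weight c hp had hmax).2
  rw [comp_eq_zero_of_lt hlt h] at h1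
  have h2 := coeff_sum_topExp c hn (fun k => wt a d (topExp p.natDegree k) =
    wt a d (topExp p.natDegree k0)) k0
  rw [← h1, if_pos rfl] at h2
  exact Finsupp.mem_support_iff.mp hk0 h2.symm

/-- The image of `y` has negative powers of `u`, but a top part is a combination of the tops of
basis elements, which lie in `ℂ[u ^ n, v ^ n, u v]`. -/
theorem toLau_comp_mem_cone (hp : p.Monic) (hn : p.natDegree ≠ 0) (had : 0 < a + d) {f : CoordRing ℂ p}
    (h : toLau p f ∈ weightLE (wt a d) s) :
    comp (wt a d) s (toLau p f) ∈ supportedOn (cone p.natDegree 0) := by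
  obtain ⟨c, rfl⟩ := exists_eq_sum f
  rw [(toLau_sum_weight c hp had fun k hk => weight_le_of_toLau c hp hn had h hk).2]
  exact sum_mem fun k _ => Submodule.smul_mem _ _ (mono_mem (topExp_mem_cone _ k))

theorem toLau_injective (hp : p.Monic) (hn : p.natDegree ≠ 0) : Function.Injective (toLau p) := by
  rw [injective_iff_map_eq_zero]
  intro f hf
  obtain ⟨c, rfl⟩ := exists_eq_sum f
  have hc : c.support = ∅ := by
    by_contra! hne
    obtain ⟨k, hk⟩ := hne
    have := weight_le_of_toLau (a := 1) (d := 1) c hp hn (by norm_num)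
      (s := wt 1 1 (topExp p.natDegree k) - 1) (by rw [hf]; exact zero_mem _) hk
    omega
  rw [hc, Finset.sum_empty]

theorem isDomain_coordRing (hp : p.Monic) (hn : p.natDegree ≠ 0) : IsDomain (CoordRing ℂ p) :=
  (toLau_injective hp hn).isDomain (toLau p).toRingHom

/-- The values on `x = u ^ n` and `z = u v` determine `P` and `Q`; the value on `y` follows by
differentiating `x y = p(z)` and cancelling `x`. -/
theorem exists_vecField (hn : p.natDegree ≠ 0)
    (D : Derivation ℂ (CoordRing ℂ p) (CoordRing ℂ p)) :
    ∃ P Q : Lau, ∀ f, toLau p (D f) = vecField P Q (toLau p f) := by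
  set n := p.natDegree with hn'
  have hn0 : (n : ℂ) ≠ 0 := Nat.cast_ne_zero.mpr hn
  obtain ⟨P, hP⟩ : ∃ P, P = (n : ℂ)⁻¹ • (mono (-(n : ℤ), 0) * toLau p (D (cx p))) := ⟨_, rfl⟩
  obtain ⟨Q, hQ⟩ : ∃ Q, Q = mono (-1, -1) * toLau p (D (cz p)) - P := ⟨_, rfl⟩
  have hx : toLau p (D (cx p)) = vecField P Q (toLau p (cx p)) := by
    rw [toLau_cx, vecField_mono]
    simp only [hP, Int.cast_natCast, Int.cast_zero, zero_smul, add_zero, smul_smul]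
    rw [mul_inv_cancel₀ hn0, one_smul, mul_right_comm, ← mono_add, ← hn']
    simp [show ((0, 0) : ℤ × ℤ) = 0 from rfl]
  have hz : toLau p (D (cz p)) = vecField P Q (toLau p (cz p)) := by
    rw [toLau_cz, vecField_mono, hQ]
    simp only [Int.cast_one, one_smul, add_sub_cancel]
    rw [mul_right_comm, ← mono_add]
    simp [show ((0, 0) : ℤ × ℤ) = 0 from rfl]
  have hy : toLau p (D (cy p)) = vecField P Q (toLau p (cy p)) := by
    have h1 := congrArg (fun f => toLau p (D f)) (cx_mul_cy p)
    have h2 := congrArg (fun f => vecField P Q (toLau p f)) (cx_mul_cy p)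
    simp only [Derivation.leibniz, Derivation.map_aeval, smul_eq_mul, map_add, map_mul,
      ← aeval_algHom_apply] at h1 h2
    rw [hz, hx, ← h2] at h1
    refine mul_left_cancel₀ (a := toLau p (cx p)) (by rw [toLau_cx]; exact mono_ne_zero _) ?_
    exact add_right_cancel h1
  refine ⟨P, Q, fun f => ?_⟩
  have hf : f ∈ Algebra.adjoin ℂ {cx p, cy p, cz p} := by rw [adjoin_generators]; trivial
  induction hf using Algebra.adjoin_induction with
  | mem f hf =>
    rcases hf with rfl | rfl | rfl
    exacts [hx, hy, hz]
  | algebraMap c => rw [Derivation.map_algebraMap, AlgHom.commutes, Derivation.map_algebraMap,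
      map_zero]
  | add f f' _ _ h h' => rw [map_add, map_add, map_add, map_add, h, h']
  | mul f f' _ _ h h' =>
    rw [Derivation.leibniz, map_mul, Derivation.leibniz, ← h, ← h', map_add, smul_eq_mul,
      smul_eq_mul, map_mul, map_mul]
    rfl

/-- The top homogeneous part of a locally nilpotent derivation. -/
theorem exists_isNilField (hp : p.Monic) (hn : p.natDegree ≠ 0) (had : 0 < a + d)
    {D : Derivation ℂ (CoordRing ℂ p) (CoordRing ℂ p)} (hD : ∀ f, ∃ n, D^[n] f = 0)
    (hD0 : D ≠ 0) : ∃ P Q : Lau, IsNilField p.natDegree P Q ∧ (P ≠ 0 ∨ Q ≠ 0) ∧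
      ∀ f s, D f = 0 → toLau p f ∈ weightLE (wt a d) s →
        vecField P Q (comp (wt a d) s (toLau p f)) = 0 := by
  obtain ⟨P, Q, hPQ⟩ := exists_vecField hn D
  have hne : P ≠ 0 ∨ Q ≠ 0 := by
    by_contra! h
    refine hD0 (Derivation.ext fun f => toLau_injective hp hn ?_)
    rw [hPQ, h.1, h.2, vecField_apply]
    simp
  -- Both coefficients are cut at one common weight; one of the two parts may vanish, but not both.
  obtain ⟨e, hP, hQ, hne'⟩ := exists_top (wt a d) P Q hne
  have hiter (k : ℕ) (f) : toLau p (D^[k] f) = (vecField P Q)^[k] (toLau p f) := by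
    induction k with
    | zero => rfl
    | succ k ih => rw [Function.iterate_succ_apply', Function.iterate_succ_apply', hPQ, ih]
  have hnil (f : CoordRing ℂ p) (s : ℤ) (hf : toLau p f ∈ weightLE (wt a d) s) :
      comp (wt a d) s (toLau p f) ∈ nilSubalgebra
        (vecField (comp (wt a d) e P) (comp (wt a d) e Q)) := by
    obtain ⟨k, hk⟩ := hD f
    refine ⟨k, ?_⟩
    rw [← (iterate_vecField_weightLE hP hQ hf k).2, ← hiter, hk, map_zero, map_zero]
  have hcone (f : CoordRing ℂ p) (s : ℤ) (hf : toLau p f ∈ weightLE (wt a d) s) :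
      vecField (comp (wt a d) e P) (comp (wt a d) e Q) (comp (wt a d) s (toLau p f)) ∈
        supportedOn (cone p.natDegree 0) := by
    rw [← comp_vecField hP hQ hf, ← hPQ]
    refine toLau_comp_mem_cone hp hn had ?_
    rw [hPQ]
    exact vecField_weightLE hP hQ hf
  have hx := toLau_cx_weight (p := p) (wt a d)
  have hz := toLau_cz_weight (p := p) (wt a d)
  have hy := toLau_cy_weight hp had
  have hn0 : (p.natDegree : ℂ) ≠ 0 := Nat.cast_ne_zero.mpr hn
  refine ⟨_, _, ⟨?_, ?_, ?_, ?_, ?_, ?_⟩, hne', fun f s hf hs => ?_⟩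
  · have := hcone _ _ hx.1
    rw [hx.2, vecField_mono] at this
    have := Submodule.smul_mem _ (p.natDegree : ℂ)⁻¹ this
    simpa [smul_smul, hn0, mul_comm] using this
  · have := hcone _ _ hy.1
    rw [hy.2, vecField_mono] at this
    have := Submodule.smul_mem _ (p.natDegree : ℂ)⁻¹ this
    simpa [smul_smul, hn0, mul_comm] using this
  · have := hcone _ _ hz.1
    rw [hz.2, vecField_mono] at this
    simpa [mul_comm] using this
  · simpa only [hx.2] using hnil _ _ hx.1
  · simpa only [hy.2] using hnil _ _ hy.1
  · simpa only [hz.2] using hnil _ _ hz.1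
  · rw [← comp_vecField hP hQ hs, ← hPQ, hf, map_zero, map_zero]

end toLau

/-! ### The embedding in `ℂ(x)[z]` -/

/-- A field of rational functions over `ℂ`. -/
abbrev RatField : Type := FractionRing (LaurentPolynomial ℂ)

/-- The variable of the field of rational functions. -/
def tVar : RatField := algebraMap (LaurentPolynomial ℂ) RatField (LaurentPolynomial.T 1)

theorem tVar_zpow (m : ℤ) :
    tVar ^ m = algebraMap (LaurentPolynomial ℂ) RatField (LaurentPolynomial.T m) := by
  have hinj := IsFractionRing.injective (LaurentPolynomial ℂ) RatField
  have hnat (k : ℕ) : tVar ^ k =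
      algebraMap (LaurentPolynomial ℂ) RatField (LaurentPolynomial.T k) := by
    rw [tVar, ← map_pow, LaurentPolynomial.T_pow, mul_one]
  obtain ⟨k, rfl | rfl⟩ := m.eq_nat_or_neg
  · rw [zpow_natCast, hnat]
  · rw [zpow_neg, zpow_natCast, hnat]
    refine inv_eq_of_mul_eq_one_right ?_
    rw [← map_mul, ← LaurentPolynomial.T_add, add_neg_cancel, LaurentPolynomial.T_zero, map_one]

theorem tVar_ne_zero : tVar ≠ 0 := by
  intro h
  have h1 := tVar_zpow (-1)
  have h2 : tVar * tVar ^ (-1 : ℤ) = 1 := by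
    rw [h1, tVar, ← map_mul, ← LaurentPolynomial.T_add, add_neg_cancel, LaurentPolynomial.T_zero,
      map_one]
  rw [h, zero_mul] at h2
  exact zero_ne_one h2

theorem linearIndependent_tVar_zpow : LinearIndependent ℂ (fun m : ℤ => tVar ^ m) := by
  rw [linearIndependent_iff']
  intro s g hg i hi
  have h1 : algebraMap (LaurentPolynomial ℂ) RatField
      (∑ i ∈ s, g i • LaurentPolynomial.T i) = 0 := by
    rw [← hg, map_sum]
    refine Finset.sum_congr rfl fun m _ => ?_
    rw [tVar_zpow, Algebra.smul_def, map_mul, Algebra.smul_def,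
      ← IsScalarTower.algebraMap_apply]
  have h2 := (map_eq_zero_iff _ (IsFractionRing.injective (LaurentPolynomial ℂ) RatField)).mp h1
  have h3 : AddMonoidAlgebra.coeff (∑ i ∈ s, g i • LaurentPolynomial.T (R := ℂ) i) i = 0 := by
    rw [h2]; rfl
  have h4 (j : ℤ) : AddMonoidAlgebra.coeff (g j • LaurentPolynomial.T (R := ℂ) j) i =
      if j = i then g j else 0 := by
    rw [AddMonoidAlgebra.coeff_smul_apply, LaurentPolynomial.T, AddMonoidAlgebra.coeff_single,
      Finsupp.single_apply, smul_eq_mul, mul_ite, mul_one, mul_zero]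
  rw [AddMonoidAlgebra.coeff_sum, Finsupp.finsetSum_apply] at h3
  simpa only [h4, Finset.sum_ite_eq', if_pos hi] using h3

theorem aeval_tVar_injective : Function.Injective (aeval (R := ℂ) tVar) := by
  rw [injective_iff_map_eq_zero]
  intro f hf
  have h := linearIndependent_tVar_zpow.comp (fun k : ℕ => (k : ℤ)) Nat.cast_injective
  rw [linearIndependent_iff'] at h
  ext k
  by_contra hk
  refine hk ?_
  rw [aeval_eq_sum_range] at hf
  refine h (Finset.range (f.natDegree + 1)) f.coeff (by simpa using hf) k ?_
  rw [Finset.mem_range_succ_iff]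
  exact le_natDegree_of_ne_zero hk

section toPoly

variable (p : ℂ[X])

/-- The embedding of the coordinate ring into `ℂ(x)[z]`. -/
def toPoly : CoordRing ℂ p →ₐ[ℂ] RatField[X] :=
  lift (C tVar) (C tVar⁻¹ * p.map (algebraMap ℂ RatField)) X (by
    rw [← mul_assoc, ← C_mul, mul_inv_cancel₀ tVar_ne_zero, C_1, one_mul, aeval_X_left_eq_map])

@[simp] theorem toPoly_cx : toPoly p (cx p) = C tVar := lift_cx _ _ _ _
@[simp] theorem toPoly_cy : toPoly p (cy p) = C tVar⁻¹ * p.map (algebraMap ℂ RatField) :=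
  lift_cy _ _ _ _
@[simp] theorem toPoly_cz : toPoly p (cz p) = X := lift_cz _ _ _ _

variable {p}

theorem toPoly_aeval_cx (g : ℂ[X]) : toPoly p (aeval (cx p) g) = C (aeval tVar g) := by
  rw [← aeval_algHom_apply, toPoly_cx]
  exact aeval_algebraMap_apply RatField[X] tVar g

theorem toPoly_basisElt (k : ℤ × ℕ) : toPoly p (basisElt p k) =
    C (tVar ^ k.1) * (p.map (algebraMap ℂ RatField) ^ (-k.1).toNat * X ^ k.2) := by
  have h : tVar ^ k.1 = tVar ^ k.1.toNat * tVar⁻¹ ^ (-k.1).toNat := by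
    conv_lhs => rw [← Int.toNat_sub_toNat_neg k.1]
    rw [zpow_sub₀ tVar_ne_zero, zpow_natCast, zpow_natCast, inv_pow, div_eq_mul_inv]
  rw [basisElt, map_mul, map_mul, map_pow, map_pow, map_pow, toPoly_cx, toPoly_cy, toPoly_cz, h,
    C_mul, C_pow, mul_pow, ← C_pow, C_pow, C_pow]
  ring

theorem natDegree_basis (hp : p.Monic) (k : ℤ × ℕ) :
    ((p.map (algebraMap ℂ RatField) ^ (-k.1).toNat * X ^ k.2).Monic) ∧
    ((p.map (algebraMap ℂ RatField) ^ (-k.1).toNat * X ^ k.2).natDegree : ℤ) =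
      (topExp p.natDegree k).2 := by
  have h1 := (hp.map (algebraMap ℂ RatField)).pow (-k.1).toNat
  refine ⟨h1.mul (monic_X_pow _), ?_⟩
  rw [h1.natDegree_mul (monic_X_pow _), natDegree_X_pow, (hp.map _).natDegree_pow,
    hp.natDegree_map, topExp]
  push_cast
  ring

/-- The degree in `z` dominates the exponents occurring in the normal form. -/
theorem topExp_le_natDegree (hp : p.Monic) (c : ℤ × ℕ →₀ ℂ) {k : ℤ × ℕ} (hk : k ∈ c.support) :
    toPoly p (∑ k ∈ c.support, c k • basisElt p k) ≠ 0 ∧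
    (topExp p.natDegree k).2 ≤ (toPoly p (∑ k ∈ c.support, c k • basisElt p k)).natDegree := by
  classical
  obtain ⟨k0, hk0, hmax⟩ := c.support.exists_max_image (fun k => (topExp p.natDegree k).2) ⟨k, hk⟩
  obtain ⟨N, hN⟩ : ∃ N : ℕ, (N : ℤ) = (topExp p.natDegree k0).2 :=
    ⟨_, (natDegree_basis hp k0).2⟩
  have hcoeff : (toPoly p (∑ k ∈ c.support, c k • basisElt p k)).coeff N =
      ∑ k ∈ c.support with (topExp p.natDegree k).2 = N, c k • tVar ^ k.1 := by
    rw [map_sum, finsetSum_coeff, Finset.sum_filter]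
    refine Finset.sum_congr rfl fun k hk => ?_
    rw [map_smul, coeff_smul, toPoly_basisElt, coeff_C_mul]
    have h1 := natDegree_basis hp k
    have h2 : (topExp p.natDegree k).2 ≤ N := hN ▸ hmax k hk
    split_ifs with h3
    · rw [← h1.2] at h3
      rw [← Nat.cast_injective h3, h1.1.coeff_natDegree, mul_one]
    · rw [coeff_eq_zero_of_natDegree_lt, mul_zero, smul_zero]
      have := lt_of_le_of_ne h2 h3
      rw [← h1.2] at this
      exact_mod_cast this
  -- For a given power of `x` the degree `N` fixes that of `z`. The coefficient of degree `N` thus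
  -- combines distinct powers of `tVar`, which are independent.
  have hinj : Set.InjOn Prod.fst
      (c.support.filter fun k => (topExp p.natDegree k).2 = N : Set (ℤ × ℕ)) := by
    rintro ⟨m, j⟩ h1 ⟨m', j'⟩ h2 (rfl : m = m')
    have h1 := (Finset.mem_filter.mp h1).2
    have h2 := (Finset.mem_filter.mp h2).2
    simp only [topExp] at h1 h2
    have : j = j' := by omega
    rw [this]
  have hne : (toPoly p (∑ k ∈ c.support, c k • basisElt p k)).coeff N ≠ 0 := by
    rw [hcoeff]
    intro h0
    have hli := linearIndependent_iff'.mp linearIndependent_tVar_zpow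
      ((c.support.filter fun k => (topExp p.natDegree k).2 = N).image Prod.fst)
      (fun m => c (m, N - p.natDegree * (-m).toNat)) (by
        rw [Finset.sum_image hinj, ← h0]
        refine Finset.sum_congr rfl fun k hk => ?_
        have hk := (Finset.mem_filter.mp hk).2
        have hk : k.2 + p.natDegree * (-k.1).toNat = N := by
          simp only [topExp] at hk
          exact_mod_cast hk
        have : k.2 = N - p.natDegree * (-k.1).toNat := by omega
        rw [← this]) k0.1 (Finset.mem_image_of_mem _ (Finset.mem_filter.mpr ⟨hk0, hN.symm⟩))
    have : k0.2 = N - p.natDegree * (-k0.1).toNat := by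
      have : N = k0.2 + p.natDegree * (-k0.1).toNat := by
        simp only [topExp] at hN
        exact_mod_cast hN
      omega
    rw [← this] at hli
    exact Finsupp.mem_support_iff.mp hk0 hli
  refine ⟨fun h => hne (by rw [h, coeff_zero]), (hmax k hk).trans ?_⟩
  rw [← hN]
  exact_mod_cast le_natDegree_of_ne_zero hne

theorem toPoly_injective (hp : p.Monic) : Function.Injective (toPoly p) := by
  rw [injective_iff_map_eq_zero]
  intro f hf
  obtain ⟨c, rfl⟩ := exists_eq_sum f
  have hc : c.support = ∅ := by
    by_contra! hne
    obtain ⟨k, hk⟩ := hne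
    exact (topExp_le_natDegree hp c hk).1 hf
  rw [hc, Finset.sum_empty]

/-- The degree bounds every term of the normal form, so only powers of `x` remain: the kernel of `x
∂/∂z` is `ℂ[x]`. -/
theorem exists_eq_aeval_of_natDegree_zero (hp : p.Monic) (hn : p.natDegree ≠ 0)
    {f : CoordRing ℂ p} (hf : (toPoly p f).natDegree = 0) : ∃ g : ℂ[X], f = aeval (cx p) g := by
  obtain ⟨c, rfl⟩ := exists_eq_sum f
  have h (k) (hk : k ∈ c.support) : basisElt p k = cx p ^ k.1.toNat := by
    have h1 := (topExp_le_natDegree hp c hk).2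
    rw [hf] at h1
    simp only [topExp] at h1
    have h2 : 0 ≤ (p.natDegree : ℤ) * (-k.1).toNat := by positivity
    have h3 : (-k.1).toNat = 0 := by
      have : (p.natDegree : ℤ) * (-k.1).toNat = 0 := by omega
      have := (mul_eq_zero.mp this).resolve_left (by exact_mod_cast hn)
      exact_mod_cast this
    have h4 : k.2 = 0 := by omega
    rw [basisElt, h3, h4, pow_zero, pow_zero, mul_one, mul_one]
  refine ⟨∑ k ∈ c.support, c k • X ^ k.1.toNat, ?_⟩
  rw [map_sum]
  refine Finset.sum_congr rfl fun k hk => ?_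
  rw [h k hk, map_smul, map_pow, aeval_X]

/-- Since `y` has `z`-degree `deg p ≥ 2`, it cannot occur. -/
theorem exists_eq_aeval_of_natDegree_le_one (hp : p.Monic) (hn : 2 ≤ p.natDegree)
    {f : CoordRing ℂ p} (hf : (toPoly p f).natDegree ≤ 1) :
    ∃ s g : ℂ[X], f = aeval (cx p) s * cz p + aeval (cx p) g := by
  obtain ⟨c, rfl⟩ := exists_eq_sum f
  have h (k) (hk : k ∈ c.support) : ∃ s g : ℂ[X],
      c k • basisElt p k = aeval (cx p) s * cz p + aeval (cx p) g := by
    have h1 := (topExp_le_natDegree hp c hk).2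
    simp only [topExp] at h1
    have h3 : (-k.1).toNat = 0 := by
      by_contra h0
      have : (2 : ℤ) * 1 ≤ (p.natDegree : ℤ) * (-k.1).toNat := by
        gcongr
        · exact_mod_cast hn
        · exact_mod_cast Nat.one_le_iff_ne_zero.mpr h0
      omega
    have h4 : k.2 = 0 ∨ k.2 = 1 := by
      have : 0 ≤ (p.natDegree : ℤ) * (-k.1).toNat := by positivity
      omega
    rcases h4 with h4 | h4
    · exact ⟨0, c k • X ^ k.1.toNat, by simp [basisElt, h3, h4]⟩
    · exact ⟨c k • X ^ k.1.toNat, 0, by simp [basisElt, h3, h4, smul_mul_assoc]⟩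
  choose! s g hsg using h
  refine ⟨∑ k ∈ c.support, s k, ∑ k ∈ c.support, g k, ?_⟩
  rw [map_sum, map_sum, Finset.sum_mul, ← Finset.sum_add_distrib]
  exact Finset.sum_congr rfl hsg

variable {q : ℂ[X]}

/-- The locally nilpotent derivation `x ∂/∂z`, transported by an isomorphism. -/
theorem exists_derivation (hq : q.Monic) (φ : CoordRing ℂ p ≃ₐ[ℂ] CoordRing ℂ q) :
    ∃ D : Derivation ℂ (CoordRing ℂ p) (CoordRing ℂ p), (∀ f, ∃ n, D^[n] f = 0) ∧ D ≠ 0 ∧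
      D (φ.symm (cx q)) = 0 := by
  have hinj : Function.Injective fun f => toPoly q (φ f) := (toPoly_injective hq).comp φ.injective
  -- The derivation exists because `x ∂/∂z` on `ℂ(x)[z]` preserves the image of the ring: `x ↦ 0`,
  -- `z ↦ x`, `y ↦ q'(z)`.
  have hex (f : CoordRing ℂ q) : ∃ g, toPoly q g = C tVar * derivative (toPoly q f) := by
    have hf : f ∈ Algebra.adjoin ℂ {cx q, cy q, cz q} := by rw [adjoin_generators]; trivial
    induction hf using Algebra.adjoin_induction with
    | mem f hf =>
      rcases hf with rfl | rfl | rfl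
      · exact ⟨0, by simp⟩
      · refine ⟨aeval (cz q) (derivative q), ?_⟩
        rw [← aeval_algHom_apply, toPoly_cz, aeval_X_left_eq_map, toPoly_cy, derivative_C_mul,
          ← mul_assoc, ← C_mul, mul_inv_cancel₀ tVar_ne_zero, C_1, one_mul, derivative_map]
      · exact ⟨cx q, by simp⟩
    | algebraMap c =>
      refine ⟨0, ?_⟩
      rw [AlgHom.commutes, Polynomial.algebraMap_apply, derivative_C, mul_zero, map_zero]
    | add f f' _ _ h h' =>
      obtain ⟨g, hg⟩ := h
      obtain ⟨g', hg'⟩ := h'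
      exact ⟨g + g', by rw [map_add, hg, hg', map_add, derivative_add, mul_add]⟩
    | mul f f' _ _ h h' =>
      obtain ⟨g, hg⟩ := h
      obtain ⟨g', hg'⟩ := h'
      refine ⟨g * f' + f * g', ?_⟩
      rw [map_add, map_mul, map_mul, hg, hg', map_mul, derivative_mul]
      ring
  have hex' (f : CoordRing ℂ p) : ∃ g, toPoly q (φ g) = C tVar * derivative (toPoly q (φ f)) := by
    obtain ⟨g, hg⟩ := hex (φ f)
    exact ⟨φ.symm g, by rw [AlgEquiv.apply_symm_apply, hg]⟩
  choose D hD using hex'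
  let D' : Derivation ℂ (CoordRing ℂ p) (CoordRing ℂ p) := Derivation.mk'
    { toFun := D
      map_add' := fun f g => hinj (by simp [hD, mul_add])
      map_smul' := fun c f => hinj (by simp [hD]) }
    (fun f g => hinj (by
      change toPoly q (φ (D (f * g))) = toPoly q (φ (f * D g + g * D f))
      simp only [hD, map_add, map_mul, derivative_mul]
      ring))
  have hD' (f) : toPoly q (φ (D' f)) = C tVar * derivative (toPoly q (φ f)) := hD f
  have hiter (n : ℕ) (f) : toPoly q (φ (D'^[n] f)) =
      C tVar ^ n * derivative^[n] (toPoly q (φ f)) := by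
    induction n with
    | zero => simp
    | succ n ih =>
      rw [Function.iterate_succ_apply', Function.iterate_succ_apply', hD', ih, ← C_pow,
        derivative_C_mul, C_pow]
      ring
  refine ⟨D', fun f => ⟨(toPoly q (φ f)).natDegree + 1, hinj ?_⟩, fun h0 => ?_, hinj ?_⟩
  · change toPoly q (φ _) = toPoly q (φ 0)
    rw [hiter, iterate_derivative_eq_zero (Nat.lt_succ_self _), mul_zero, map_zero, map_zero]
  · have := hD' (φ.symm (cz q))
    rw [h0] at this
    simp only [Derivation.zero_apply, map_zero, AlgEquiv.apply_symm_apply, toPoly_cz,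
      derivative_X, mul_one] at this
    exact tVar_ne_zero (C_eq_zero.mp this.symm)
  · change toPoly q (φ _) = toPoly q (φ 0)
    rw [hD', AlgEquiv.apply_symm_apply, toPoly_cx, derivative_C, mul_zero, map_zero, map_zero]

end toPoly

/-! ### Shears -/

section Shear

theorem sub_dvd_aeval_sub_aeval {k A : Type*} [CommRing k] [CommRing A] [Algebra k A] (a b : A)
    (p : k[X]) : a - b ∣ aeval a p - aeval b p := by
  rw [aeval_def, aeval_def, ← Polynomial.eval_map, ← Polynomial.eval_map]
  exact sub_dvd_eval_sub _ _ _

variable {p : ℂ[X]}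

/-- The automorphism `x ↦ x`, `z ↦ z - c x ^ l`. -/
theorem exists_shear (hp : p.Monic) (hn : p.natDegree ≠ 0) (c : ℂ) {l : ℕ} (hl : l ≠ 0) :
    ∃ σ : CoordRing ℂ p ≃ₐ[ℂ] CoordRing ℂ p, σ (cx p) = cx p ∧
      σ (cz p) = cz p - c • cx p ^ l := by
  have := isDomain_coordRing hp hn
  have hx0 : cx p ≠ 0 := by
    intro h
    have := congrArg (toLau p) h
    rw [toLau_cx, map_zero] at this
    exact mono_ne_zero _ this
  have hex (c : ℂ) : ∃ σ : CoordRing ℂ p →ₐ[ℂ] CoordRing ℂ p, σ (cx p) = cx p ∧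
      σ (cz p) = cz p - c • cx p ^ l := by
    -- The image of `y` has to be `p(z - c x ^ l) / x`, which lies in the ring because `l ≥ 1`.
    have h1 : cx p ∣ aeval (cz p - c • cx p ^ l) p := by
      have h2 : cx p ∣ aeval (cz p) p := ⟨cy p, (cx_mul_cy p).symm⟩
      have h3 : cz p - (cz p - c • cx p ^ l) ∣
          aeval (cz p) p - aeval (cz p - c • cx p ^ l) p := sub_dvd_aeval_sub_aeval _ _ _
      have h4 : cx p ∣ cz p - (cz p - c • cx p ^ l) := by
        rw [sub_sub_cancel]
        exact dvd_smul_of_dvd c (dvd_pow_self _ hl)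
      exact (dvd_sub_right h2).mp (h4.trans h3)
    obtain ⟨y, hy⟩ := h1
    exact ⟨lift (cx p) y (cz p - c • cx p ^ l) hy.symm, by simp, by simp⟩
  have hid (σ τ : CoordRing ℂ p →ₐ[ℂ] CoordRing ℂ p) (c : ℂ) (h1 : σ (cx p) = cx p)
      (h2 : τ (cx p) = cx p) (h3 : σ (cz p) = cz p - c • cx p ^ l)
      (h4 : τ (cz p) = cz p - (-c) • cx p ^ l) : σ.comp τ = AlgHom.id ℂ _ := by
    have hx : (σ.comp τ) (cx p) = cx p := by rw [AlgHom.comp_apply, h2, h1]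
    have hz : (σ.comp τ) (cz p) = cz p := by
      rw [AlgHom.comp_apply, h4, map_sub, h3, map_smul, map_pow, h1, neg_smul]
      ring
    refine algHom_ext hx ?_ hz
    refine mul_left_cancel₀ hx0 ?_
    have h5 := congrArg (σ.comp τ) (cx_mul_cy p)
    rw [map_mul, hx, ← aeval_algHom_apply, hz, ← cx_mul_cy] at h5
    exact h5
  obtain ⟨σ, h1, h2⟩ := hex c
  obtain ⟨τ, h3, h4⟩ := hex (-c)
  exact ⟨AlgEquiv.ofAlgHom σ τ (hid σ τ c h1 h3 h2 h4)
    (hid τ σ (-c) h3 h1 h4 (by rw [h2, neg_neg])), h1, h2⟩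

end Shear

/-! ### Lowering the degree of an isomorphism -/

section Reduction

variable {p q : ℂ[X]}

theorem natDegree_sub_lt_of_leadingCoeff {K : Type*} [Field K] {f g : K[X]} {b : ℕ} (hb : 0 < b)
    (hf : f.natDegree = b) (hg : g.natDegree = b) (h : f.leadingCoeff = g.leadingCoeff) :
    (f - g).natDegree < b := by
  have h1 : (f - g).natDegree ≤ b := (natDegree_sub_le_of_le hf.le hg.le).trans_eq (max_self b)
  have h2 : (f - g).coeff b = 0 := by
    rw [coeff_sub, sub_eq_zero]
    rwa [leadingCoeff, leadingCoeff, hf, hg] at h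
  refine lt_of_le_of_ne h1 fun h3 => ?_
  rw [← h3] at h2
  rw [leadingCoeff_eq_zero.mp h2, natDegree_zero] at h3
  exact hb.ne h3

theorem natDegree_sub_smul_pow_lt {K : Type*} [Field K] [Algebra ℂ K] {f g : K[X]} {c : ℂ} {l : ℕ}
    (hf : 0 < f.natDegree) (hc : c ≠ 0) (h : f.natDegree = l * g.natDegree)
    (h' : f.leadingCoeff = algebraMap ℂ K c * g.leadingCoeff ^ l) :
    (f - c • g ^ l).natDegree < f.natDegree := by
  have hc' : algebraMap ℂ K c ≠ 0 := by simpa using hc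
  have h1 : c • g ^ l = C (algebraMap ℂ K c) * g ^ l := by
    rw [← algebraMap_smul K c, smul_eq_C_mul]
  rw [h1]
  refine natDegree_sub_lt_of_leadingCoeff hf rfl ?_ ?_
  · rw [natDegree_C_mul hc', natDegree_pow, h]
  · rw [leadingCoeff_mul, leadingCoeff_C, leadingCoeff_pow, h']

/-- The evaluation `u ↦ a`, `v ↦ b` of Laurent polynomials. -/
def evalLau {K : Type*} [Field K] [Algebra ℂ K] (a b : K) (ha : a ≠ 0) (hb : b ≠ 0) :
    Lau →ₐ[ℂ] K :=
  AddMonoidAlgebra.lift ℂ K (ℤ × ℤ)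
    { toFun := fun m => a ^ m.toAdd.1 * b ^ m.toAdd.2
      map_one' := by simp
      map_mul' := fun m m' => by
        rw [toAdd_mul, Prod.fst_add, Prod.snd_add, zpow_add₀ ha, zpow_add₀ hb]
        ring }

theorem evalLau_mono {K : Type*} [Field K] [Algebra ℂ K] {a b : K} (ha : a ≠ 0) (hb : b ≠ 0)
    (m : ℤ × ℤ) : evalLau a b ha hb (mono m) = a ^ m.1 * b ^ m.2 := by
  rw [evalLau, mono, AddMonoidAlgebra.lift_single, one_smul]
  rfl

set_option maxHeartbeats 1000000 in
/-- If `x` and `y` both have positive degree, an elementary change of variables lowers the degree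
of `z`. -/
theorem exists_leading_relation (hp : p.Monic) (hn : p.natDegree ≠ 0) (hq : q.Monic)
    (φ : CoordRing ℂ p ≃ₐ[ℂ] CoordRing ℂ q) (ha : 0 < (toPoly q (φ (cx p))).natDegree)
    (hd : 0 < (toPoly q (φ (cy p))).natDegree) :
    ∃ (c : ℂ) (l : ℕ), l ≠ 0 ∧
      ((toPoly q (φ (cz p - c • cx p ^ l))).natDegree < (toPoly q (φ (cz p))).natDegree ∨
       (toPoly q (φ (cz p - c • cy p ^ l))).natDegree < (toPoly q (φ (cz p))).natDegree) := by
  set n := p.natDegree with hn_def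
  obtain ⟨x, hx⟩ : ∃ x, x = toPoly q (φ (cx p)) := ⟨_, rfl⟩
  obtain ⟨y, hy⟩ : ∃ y, y = toPoly q (φ (cy p)) := ⟨_, rfl⟩
  obtain ⟨z, hz⟩ : ∃ z, z = toPoly q (φ (cz p)) := ⟨_, rfl⟩
  rw [← hx] at ha
  rw [← hy] at hd
  rw [← hz]
  have hxy : x * y = (p.map (algebraMap ℂ RatField)).comp z := by
    have h1 := congrArg ((toPoly q).comp (φ : CoordRing ℂ p →ₐ[ℂ] CoordRing ℂ q)) (cx_mul_cy p)
    rw [map_mul] at h1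
    rw [hx, hy, hz, Polynomial.comp, eval₂_map]
    exact h1.trans (aeval_algHom_apply _ (cz p) p).symm
  have hx0 : x ≠ 0 := by rintro rfl; simp at ha
  have hy0 : y ≠ 0 := by rintro rfl; simp at hd
  have hdeg : x.natDegree + y.natDegree = n * z.natDegree := by
    rw [← natDegree_mul hx0 hy0, hxy, natDegree_comp, hp.natDegree_map]
  have hb : 0 < z.natDegree := by
    rw [Nat.pos_iff_ne_zero]
    intro h0
    rw [h0, mul_zero] at hdeg
    omega
  have hz0 : z ≠ 0 := by rintro rfl; simp at hb
  have hlead : x.leadingCoeff * y.leadingCoeff = z.leadingCoeff ^ n := by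
    rw [← leadingCoeff_mul, hxy, leadingCoeff_comp hb.ne', (hp.map _).leadingCoeff, one_mul,
      hp.natDegree_map]
  let K := AlgebraicClosure RatField
  have hK := (algebraMap RatField K).injective
  have hK0 {a : RatField} (h : a ≠ 0) : algebraMap RatField K a ≠ 0 :=
    (map_ne_zero_iff _ hK).mpr h
  -- The point `(u, v)` is chosen so that `u ^ n`, `v ^ n`, `u v` are the leading coefficients of
  -- `x`, `y`, `z`; the root `u` requires the algebraic closure.
  obtain ⟨u, hu⟩ : ∃ u : K, u ^ n = algebraMap RatField K x.leadingCoeff :=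
    IsAlgClosed.exists_pow_nat_eq _ (Nat.pos_of_ne_zero hn)
  have hu0 : u ≠ 0 := by
    rintro rfl
    rw [zero_pow hn] at hu
    exact hK0 (leadingCoeff_ne_zero.mpr hx0) hu.symm
  obtain ⟨v, hv⟩ : ∃ v : K, v = algebraMap RatField K z.leadingCoeff / u := ⟨_, rfl⟩
  have huv : u * v = algebraMap RatField K z.leadingCoeff := by
    rw [hv, mul_div_cancel₀ _ hu0]
  have hv0 : v ≠ 0 := by
    rintro rfl
    rw [mul_zero] at huv
    exact hK0 (leadingCoeff_ne_zero.mpr hz0) huv.symm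
  have hvn : v ^ n = algebraMap RatField K y.leadingCoeff := by
    refine mul_left_cancel₀ (pow_ne_zero n hu0) ?_
    rw [← mul_pow, huv, hu, ← map_mul, hlead, map_pow]
  obtain ⟨D, hDnil, hD0, hDX⟩ := exists_derivation hq φ
  obtain ⟨P, Q, hfield, hne, htop⟩ := exists_isNilField (a := x.natDegree) (d := y.natDegree)
    hp hn (by omega) hDnil hD0
  obtain ⟨c, hc⟩ := exists_eq_sum (φ.symm (cx q))
  let w := wt x.natDegree y.natDegree
  -- Weighting `u`, `v` by the degrees of `x`, `y` makes the weight of a top monomial `n` times the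
  -- degree of the image, and its value at `(u, v)` the leading coefficient.
  have hwbasis (k : ℤ × ℕ) : (toPoly q (φ (basisElt p k))).natDegree * (n : ℤ) = w (topExp n k) ∧
      algebraMap RatField K (toPoly q (φ (basisElt p k))).leadingCoeff =
        evalLau u v hu0 hv0 (mono (topExp n k)) := by
    have h1 : toPoly q (φ (basisElt p k)) = x ^ k.1.toNat * y ^ (-k.1).toNat * z ^ k.2 := by
      simp only [basisElt, map_mul, map_pow, hx, hy, hz]
    constructor
    · rw [h1, natDegree_mul (mul_ne_zero (pow_ne_zero _ hx0) (pow_ne_zero _ hy0))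
        (pow_ne_zero _ hz0), natDegree_mul (pow_ne_zero _ hx0) (pow_ne_zero _ hy0),
        natDegree_pow, natDegree_pow, natDegree_pow]
      have : (x.natDegree + y.natDegree : ℤ) = n * z.natDegree := by exact_mod_cast hdeg
      simp only [w, wt_apply, topExp]
      push_cast
      linear_combination (-(k.2 : ℤ)) * this
    · rw [h1, leadingCoeff_mul, leadingCoeff_mul, leadingCoeff_pow, leadingCoeff_pow,
        leadingCoeff_pow, map_mul, map_mul, map_pow, map_pow, map_pow, ← hu, ← hvn, ← huv,
        evalLau_mono, topExp]
      simp only [zpow_add₀ hu0, zpow_add₀ hv0, zpow_mul, zpow_natCast]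
      ring
  have hcne : c.support.Nonempty := by
    rw [Finset.nonempty_iff_ne_empty]
    intro h
    rw [h, Finset.sum_empty] at hc
    have := congrArg (fun f => toPoly q (φ f)) hc
    simp [tVar_ne_zero] at this
  obtain ⟨k0, hk0, hmax⟩ := c.support.exists_max_image (fun k => w (topExp n k)) hcne
  have hweight := toLau_sum_weight c hp (by omega) hmax
  rw [← hc] at hweight
  obtain ⟨F, hF⟩ : ∃ F, F = comp w (w (topExp n k0)) (toLau p (φ.symm (cx q))) := ⟨_, rfl⟩
  have hFsum : F = ∑ k ∈ c.support with w (topExp n k) = w (topExp n k0),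
      c k • mono (topExp n k) := hF.trans hweight.2
  have hF0 : F ≠ 0 := by
    intro h0
    have := coeff_sum_topExp c hn (fun k => w (topExp n k) = w (topExp n k0)) k0
    rw [← hFsum, h0, if_pos rfl] at this
    exact Finsupp.mem_support_iff.mp hk0 this.symm
  have hnatle (k) (hk : k ∈ c.support) : (toPoly q (φ (basisElt p k))).natDegree ≤
      (toPoly q (φ (basisElt p k0))).natDegree := by
    have h1 := hmax k hk
    rw [← (hwbasis k).1, ← (hwbasis k0).1] at h1
    exact_mod_cast le_of_mul_le_mul_right h1 (by exact_mod_cast Nat.pos_of_ne_zero hn)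
  -- Otherwise `φ⁻¹ x` would be a constant.
  have hN0 : (toPoly q (φ (basisElt p k0))).natDegree ≠ 0 := by
    intro h0
    have hall (k) (hk : k ∈ c.support) : k = (0, 0) := by
      have h1 := hnatle k hk
      rw [h0] at h1
      have h2 := (hwbasis k).1
      rw [Nat.le_zero.mp h1] at h2
      simp only [w, wt_apply, topExp, Nat.cast_zero, zero_mul] at h2
      have h3 : 0 ≤ (k.2 + n * k.1.toNat : ℤ) := by positivity
      have h4 : 0 ≤ (k.2 + n * (-k.1).toNat : ℤ) := by positivity
      have ha' : (0 : ℤ) < x.natDegree := by exact_mod_cast ha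
      have hd' : (0 : ℤ) < y.natDegree := by exact_mod_cast hd
      have h5 : (k.2 + n * k.1.toNat : ℤ) = 0 := by nlinarith
      have h6 : (k.2 + n * (-k.1).toNat : ℤ) = 0 := by nlinarith
      have : topExp n k = topExp n (0, 0) := by
        refine Prod.ext ?_ ?_
        · exact h5.trans (by simp [topExp])
        · exact h6.trans (by simp [topExp])
      exact topExp_injective hn this
    have hcs : φ.symm (cx q) ∈ (⊥ : Subalgebra ℂ (CoordRing ℂ p)) := by
      rw [hc]
      refine sum_mem fun k hk => Subalgebra.smul_mem _ ?_ _
      rw [hall k hk]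
      simp [basisElt]
    obtain ⟨c0, hc0⟩ := Algebra.mem_bot.mp hcs
    have h1 := congrArg (fun f => toPoly q (φ f)) hc0
    simp only [AlgEquiv.commutes, AlgHom.commutes, AlgEquiv.apply_symm_apply, toPoly_cx] at h1
    have h2 : aeval tVar (C c0 : ℂ[X]) = aeval tVar (X : ℂ[X]) := by
      rw [aeval_C, aeval_X]
      exact C_injective h1
    exact X_ne_C c0 (aeval_tVar_injective h2).symm
  -- The sum of the images is `C tVar`, of degree 0 and so below the degree of the dominant terms:
  -- their leading coefficients cancel.
  have hev : evalLau u v hu0 hv0 F = 0 := by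
    have h1 : (toPoly q (φ (φ.symm (cx q)))).coeff (toPoly q (φ (basisElt p k0))).natDegree = 0 := by
      rw [AlgEquiv.apply_symm_apply, toPoly_cx, coeff_C, if_neg hN0]
    rw [hc, map_sum, map_sum, finsetSum_coeff] at h1
    have h2 := congrArg (algebraMap RatField K) h1
    rw [map_zero, map_sum] at h2
    rw [hFsum, map_sum, Finset.sum_filter]
    refine Eq.trans (Finset.sum_congr rfl fun k hk => ?_) h2
    have h3 : algebraMap RatField K ((toPoly q (φ (c k • basisElt p k))).coeff
        (toPoly q (φ (basisElt p k0))).natDegree) = c k • algebraMap RatField K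
        ((toPoly q (φ (basisElt p k))).coeff (toPoly q (φ (basisElt p k0))).natDegree) := by
      rw [map_smul φ, map_smul (toPoly q), coeff_smul, Algebra.smul_def, Algebra.smul_def, map_mul,
        ← IsScalarTower.algebraMap_apply]
    rw [h3, map_smul, ← (hwbasis k).2]
    split_ifs with h4
    · rw [← (hwbasis k).1, ← (hwbasis k0).1] at h4
      have h5 := mul_right_cancel₀ (by exact_mod_cast hn) h4
      rw [← Nat.cast_injective h5, leadingCoeff]
    · have h5 : (toPoly q (φ (basisElt p k))).natDegree ≠
          (toPoly q (φ (basisElt p k0))).natDegree := fun h5 =>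
        h4 (by rw [← (hwbasis k).1, ← (hwbasis k0).1, h5])
      rw [coeff_eq_zero_of_natDegree_lt (lt_of_le_of_ne (hnatle k hk) h5), map_zero, smul_zero]
  -- A nonzero multiple of a monomial does not vanish at `(u, v)`, so `F` is a multiple of a power
  -- of a binomial.
  obtain ⟨a', d', N, c0, r, had, hone, hdvd, hc0, hr, hFpow⟩ := hfield.exists_eq_pow_binom hn hne
    ha hd (hF ▸ toLau_comp_mem_cone hp hn (by omega) hweight.1)
    (W := w (topExp n k0)) (F := F) (fun m hm => weight_of_comp (hF ▸ hm)) (fun c m h => by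
      rw [h, map_smul, evalLau_mono, smul_eq_zero] at hev
      rcases hev with rfl | h1
      · exact hF0 (by rw [h, zero_smul])
      · exact mul_ne_zero (zpow_ne_zero _ hu0) (zpow_ne_zero _ hv0) h1)
    (hF ▸ htop _ _ hDX hweight.1)
  have hrel : v ^ a' = algebraMap ℂ K r * u ^ d' := by
    rw [hFpow, map_smul, map_pow, smul_eq_zero] at hev
    have := eq_zero_of_pow_eq_zero (hev.resolve_left hc0)
    rw [binom, map_sub, map_smul, evalLau_mono, evalLau_mono, sub_eq_zero] at this
    simpa [Algebra.smul_def] using this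
  obtain ⟨l, hl⟩ := hdvd
  -- If `a' = 1`, then `u v = r u ^ (1 + d') = r (u ^ n) ^ l`, so `r x ^ l` has the leading term of
  -- `z`. If `d' = 1`, then `u v = r⁻¹ v ^ (a' + 1) = r⁻¹ (v ^ n) ^ l`.
  rcases hone with rfl | rfl
  · refine ⟨r, l, by rintro rfl; omega, Or.inl ?_⟩
    have hz' : z.leadingCoeff = algebraMap ℂ RatField r * x.leadingCoeff ^ l := by
      apply hK
      rw [map_mul, map_pow, ← huv, ← hu, ← pow_mul, ← hl, ← IsScalarTower.algebraMap_apply,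
        pow_add, pow_one, mul_left_comm, ← hrel, pow_one]
    have hbl : z.natDegree = l * x.natDegree := by
      refine Nat.eq_of_mul_eq_mul_left (Nat.pos_of_ne_zero hn) ?_
      rw [← hdeg, ← mul_assoc, ← hl]
      linarith
    rw [map_sub, map_sub, map_smul, map_smul, map_pow, map_pow, ← hx, ← hz]
    exact natDegree_sub_smul_pow_lt hb hr hbl hz'
  · refine ⟨r⁻¹, l, by rintro rfl; omega, Or.inr ?_⟩
    have hrK : algebraMap ℂ K r ≠ 0 := by simpa using hr
    have hz' : z.leadingCoeff = algebraMap ℂ RatField r⁻¹ * y.leadingCoeff ^ l := by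
      apply hK
      rw [map_mul, map_pow, ← huv, ← hvn, ← pow_mul, ← hl, ← IsScalarTower.algebraMap_apply,
        pow_add, pow_one, hrel, map_inv₀, pow_one, mul_assoc, inv_mul_cancel_left₀ hrK]
    have hbl : z.natDegree = l * y.natDegree := by
      refine Nat.eq_of_mul_eq_mul_left (Nat.pos_of_ne_zero hn) ?_
      rw [← hdeg, ← mul_assoc, ← hl]
      linarith
    rw [map_sub, map_sub, map_smul, map_smul, map_pow, map_pow, ← hy, ← hz]
    exact natDegree_sub_smul_pow_lt hb (inv_ne_zero hr) hbl hz'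

/-- Up to automorphisms, `x` is sent into the kernel of `x ∂/∂z`. -/
theorem exists_natDegree_eq_zero (hp : p.Monic) (hn : p.natDegree ≠ 0) (hq : q.Monic)
    (φ : CoordRing ℂ p ≃ₐ[ℂ] CoordRing ℂ q) :
    ∃ ψ : CoordRing ℂ p ≃ₐ[ℂ] CoordRing ℂ q, (toPoly q (ψ (cx p))).natDegree = 0 := by
  induction hb : (toPoly q (φ (cz p))).natDegree using Nat.strong_induction_on generalizing φ with
  | _ b ih =>
  subst hb
  by_cases ha : (toPoly q (φ (cx p))).natDegree = 0
  · exact ⟨φ, ha⟩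
  by_cases hd : (toPoly q (φ (cy p))).natDegree = 0
  · exact ⟨(swap p).trans φ, by rwa [AlgEquiv.trans_apply, swap_cx]⟩
  obtain ⟨c, l, hl, h | h⟩ := exists_leading_relation hp hn hq φ (Nat.pos_of_ne_zero ha)
    (Nat.pos_of_ne_zero hd)
  · obtain ⟨σ, -, hσ⟩ := exists_shear hp hn c hl
    exact ih _ h (σ.trans φ) (by rw [AlgEquiv.trans_apply, hσ])
  · obtain ⟨σ, -, hσ⟩ := exists_shear hp hn c hl
    refine ih _ h (σ.trans ((swap p).trans φ)) ?_
    rw [AlgEquiv.trans_apply, hσ, AlgEquiv.trans_apply, map_sub (swap p), map_smul (swap p),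
      map_pow (swap p), swap_cx, swap_cz]

end Reduction

/-! ### Triangular isomorphisms -/

section Triangular

variable {p q : ℂ[X]}

theorem cx_ne_zero (p : ℂ[X]) : cx p ≠ 0 := by
  intro h
  have := congrArg (toPoly p) h
  rw [toPoly_cx, map_zero, C_eq_zero] at this
  exact tVar_ne_zero this

theorem aeval_cx_injective (p : ℂ[X]) : Function.Injective (aeval (R := ℂ) (cx p)) := by
  intro f g h
  have := congrArg (toPoly p) h
  rw [toPoly_aeval_cx, toPoly_aeval_cx] at this
  exact aeval_tVar_injective (C_injective this)

/-- Once `x` is a nonzero scalar of `K`, `y = p(z) / x` is a polynomial in `z`. -/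
theorem exists_eq_comp_of_map_cx {K : Type*} [Field K] [Algebra ℂ K]
    (Ψ : CoordRing ℂ p →ₐ[ℂ] K[X]) {ξ : K} (hξ : ξ ≠ 0) (h : Ψ (cx p) = C ξ)
    (F : CoordRing ℂ p) : ∃ P : K[X], Ψ F = P.comp (Ψ (cz p)) := by
  have hF : F ∈ Algebra.adjoin ℂ {cx p, cy p, cz p} := by rw [adjoin_generators]; trivial
  induction hF using Algebra.adjoin_induction with
  | mem f hf =>
    rcases hf with rfl | rfl | rfl
    · exact ⟨C ξ, by rw [h, C_comp]⟩
    · refine ⟨C ξ⁻¹ * p.map (algebraMap ℂ K), ?_⟩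
      have h1 := congrArg Ψ (cx_mul_cy p)
      rw [map_mul, h] at h1
      rw [mul_comp, C_comp, Polynomial.comp, eval₂_map]
      have h2 : Ψ (aeval (cz p) p) = eval₂ (C.comp (algebraMap ℂ K)) (Ψ (cz p)) p :=
        (aeval_algHom_apply Ψ (cz p) p).symm
      rw [← h2, ← h1, ← mul_assoc, ← C_mul, inv_mul_cancel₀ hξ, C_1, one_mul]
    · exact ⟨X, by rw [X_comp]⟩
  | algebraMap c => exact ⟨algebraMap ℂ _ c, by rw [AlgHom.commutes, Polynomial.algebraMap_apply, C_comp]⟩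
  | add f g _ _ hf hg =>
    obtain ⟨P, hP⟩ := hf
    obtain ⟨Q, hQ⟩ := hg
    exact ⟨P + Q, by rw [map_add, hP, hQ, add_comp]⟩
  | mul f g _ _ hf hg =>
    obtain ⟨P, hP⟩ := hf
    obtain ⟨Q, hQ⟩ := hg
    exact ⟨P * Q, by rw [map_mul, hP, hQ, mul_comp]⟩

/-- Since `f` is nonconstant and `f(ψ⁻¹ x) = x` has `z`-degree 0, so has `ψ⁻¹ x`. The composition
identity will force `f` and `g` to be linear. -/
theorem exists_map_cx_eq_aeval (hp : p.Monic) (hn : p.natDegree ≠ 0) (hq : q.Monic)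
    (hn' : q.natDegree ≠ 0) (ψ : CoordRing ℂ p ≃ₐ[ℂ] CoordRing ℂ q)
    (h : (toPoly q (ψ (cx p))).natDegree = 0) :
    ∃ f g : ℂ[X], ψ (cx p) = aeval (cx q) f ∧ ψ.symm (cx q) = aeval (cx p) g ∧ f.comp g = X := by
  obtain ⟨f, hf⟩ := exists_eq_aeval_of_natDegree_zero hq hn' h
  have h1 : aeval (ψ.symm (cx q)) f = cx p := by
    have := congrArg ψ.symm hf
    rw [ψ.symm_apply_apply] at this
    exact (aeval_algHom_apply (ψ.symm : CoordRing ℂ q →ₐ[ℂ] CoordRing ℂ p) _ _).trans this.symm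
  have hfdeg : f.natDegree ≠ 0 := by
    intro h0
    rw [eq_C_of_natDegree_eq_zero h0, aeval_C] at h1
    have h2 : aeval (cx p) (C (f.coeff 0)) = aeval (cx p) (X : ℂ[X]) :=
      (aeval_C _ _).trans (h1.trans (aeval_X _).symm)
    exact X_ne_C _ (aeval_cx_injective p h2).symm
  have h2 : (toPoly p (ψ.symm (cx q))).natDegree = 0 := by
    have h3 := congrArg (toPoly p) h1
    have h4 : toPoly p (aeval (ψ.symm (cx q)) f) =
        (f.map (algebraMap ℂ RatField)).comp (toPoly p (ψ.symm (cx q))) := by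
      rw [Polynomial.comp, eval₂_map]
      exact (aeval_algHom_apply (toPoly p) _ _).symm
    rw [h4, toPoly_cx] at h3
    have h5 := congrArg natDegree h3
    rw [natDegree_comp, natDegree_C, natDegree_map] at h5
    exact (mul_eq_zero.mp h5).resolve_left hfdeg
  obtain ⟨g, hg⟩ := exists_eq_aeval_of_natDegree_zero hp hn h2
  refine ⟨f, g, hf, hg, aeval_cx_injective p ?_⟩
  have h3 : aeval (cx p) (f.comp g) = aeval (aeval (cx p) g) f := aeval_comp _
  rw [h3, ← hg, h1]
  exact (aeval_X _).symm

/-- Over `ℂ(x)` the variable `z` is a polynomial in `ψ z`, so the degree of `ψ z` divides 1. -/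
theorem exists_map_cz_eq (hq : q.Monic) (hn : 2 ≤ q.natDegree)
    (ψ : CoordRing ℂ p ≃ₐ[ℂ] CoordRing ℂ q) {f : ℂ[X]} (hf : ψ (cx p) = aeval (cx q) f) :
    ∃ s g : ℂ[X], ψ (cz p) = aeval (cx q) s * cz q + aeval (cx q) g := by
  refine exists_eq_aeval_of_natDegree_le_one hq hn ?_
  let Ψ := (toPoly q).comp (ψ : CoordRing ℂ p →ₐ[ℂ] CoordRing ℂ q)
  have h1 : Ψ (cx p) = C (aeval tVar f) := by
    change toPoly q (ψ (cx p)) = _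
    rw [hf, toPoly_aeval_cx]
  have h2 : aeval tVar f ≠ 0 := by
    intro h0
    rw [← map_zero (aeval (R := ℂ) tVar)] at h0
    rw [aeval_tVar_injective h0, map_zero, map_eq_zero_iff _ ψ.injective] at hf
    exact cx_ne_zero p hf
  obtain ⟨P, hP⟩ := exists_eq_comp_of_map_cx Ψ h2 h1 (ψ.symm (cz q))
  have h3 : X = P.comp (toPoly q (ψ (cz p))) := by
    rw [← toPoly_cz, ← ψ.apply_symm_apply (cz q)]
    exact hP
  have h4 := congrArg natDegree h3
  rw [natDegree_X, natDegree_comp] at h4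
  exact (Nat.dvd_one.mp ⟨_, h4.trans (mul_comm _ _)⟩).le

/-- An isomorphism which is compatible with the projections to the `x`-line matches the zeros of
the defining polynomials. -/
theorem exists_dvd_comp (hp : p.Monic) (hn : 2 ≤ p.natDegree) (hq : q.Monic)
    (hn' : 2 ≤ q.natDegree) (ψ : CoordRing ℂ p ≃ₐ[ℂ] CoordRing ℂ q)
    (h : (toPoly q (ψ (cx p))).natDegree = 0) :
    ∃ a b : ℂ, a ≠ 0 ∧ q ∣ p.comp (C a * X + C b) := by
  obtain ⟨f, f', hf, hf', hff⟩ := exists_map_cx_eq_aeval hp (by omega) hq (by omega) ψ h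
  obtain ⟨s, g, hz⟩ := exists_map_cz_eq hq hn' ψ hf
  obtain ⟨s', g', hz'⟩ := exists_map_cz_eq hp hn ψ.symm hf'
  have hdeg : f.natDegree = 1 ∧ f'.natDegree = 1 := by
    have := congrArg natDegree hff
    rw [natDegree_comp, natDegree_X] at this
    exact mul_eq_one.mp this
  -- Comparing coefficients of `z` in `ψ⁻¹ (ψ z) = z` makes `s.comp f'` a unit; as `f'` is linear,
  -- `s` is constant.
  have hs : s.comp f' * s' = 1 := by
    let Φ : CoordRing ℂ q →ₐ[ℂ] CoordRing ℂ p := ψ.symm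
    have h1 (r : ℂ[X]) : toPoly p (Φ (aeval (cx q) r)) = C (aeval tVar (r.comp f')) := by
      have h2 : Φ (aeval (cx q) r) = aeval (cx p) (r.comp f') := by
        refine (aeval_algHom_apply Φ _ _).symm.trans ?_
        change aeval (ψ.symm (cx q)) r = _
        rw [hf']
        exact (aeval_comp _).symm
      rw [h2, toPoly_aeval_cx]
    have h3 := congrArg (fun F => toPoly p (Φ F)) hz
    change toPoly p (ψ.symm (ψ (cz p))) = toPoly p (Φ _) at h3
    have h4 : toPoly p (Φ (cz q)) = C (aeval tVar s') * X + C (aeval tVar g') := by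
      change toPoly p (ψ.symm (cz q)) = _
      rw [hz', map_add, map_mul, toPoly_aeval_cx, toPoly_aeval_cx, toPoly_cz]
    rw [ψ.symm_apply_apply, toPoly_cz, map_add, map_mul, map_add, map_mul, h1, h1, h4] at h3
    have h5 := congrArg (fun P => coeff P 1) h3
    simp only [coeff_X_one, coeff_add, coeff_C_mul, coeff_C_succ, mul_one, add_zero] at h5
    apply aeval_tVar_injective
    rw [map_mul, map_one, ← h5]
  obtain ⟨a, rfl⟩ : ∃ a, s = C a := by
    have h1 := natDegree_eq_zero_of_isUnit (IsUnit.of_mul_eq_one _ hs)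
    rw [natDegree_comp, hdeg.2, mul_one] at h1
    exact ⟨_, eq_C_of_natDegree_eq_zero h1⟩
  have ha : a ≠ 0 := by
    rintro rfl
    simp at hs
  -- On the fibre of `D_q` over a zero `t` of `f`, the image of `x` vanishes, hence so does `p(a z +
  -- g(t))`.
  have hrel {B : Type} [CommRing B] [Algebra ℂ B] (Φ : CoordRing ℂ q →ₐ[ℂ] B)
      (t : ℂ) (ht : Φ (cx q) = algebraMap ℂ B t) (hft : f.eval t = 0) :
      aeval (Φ (cz q)) (p.comp (C a * X + C (g.eval t))) = 0 := by
    have h1 (r : ℂ[X]) : Φ (aeval (cx q) r) = algebraMap ℂ B (r.eval t) := by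
      refine (aeval_algHom_apply Φ _ _).symm.trans ?_
      rw [ht, aeval_algebraMap_apply, coe_aeval_eq_eval]
    have h2 := congrArg (Φ.comp (ψ : CoordRing ℂ p →ₐ[ℂ] CoordRing ℂ q)) (cx_mul_cy p)
    have h3 := h2.trans
      (aeval_algHom_apply (Φ.comp (ψ : CoordRing ℂ p →ₐ[ℂ] CoordRing ℂ q)) _ _).symm
    rw [map_mul] at h3
    change Φ (ψ (cx p)) * _ = aeval (Φ (ψ (cz p))) p at h3
    rw [hf, h1, hft, map_zero, zero_mul, hz, map_add, map_mul, h1, h1, eval_C] at h3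
    rw [aeval_comp, h3]
    simp
  obtain ⟨t, ht⟩ : ∃ t, f.eval t = 0 :=
    IsAlgClosed.exists_root f (by rw [degree_eq_natDegree (by rintro rfl; simp at hdeg), hdeg.1]; simp)
  refine ⟨a, g.eval t, ha, ?_⟩
  -- For `t = 0` the fibre has the points `y = 0`, `q(z) = 0`, whence the divisibility. For `t ≠ 0`
  -- the coordinate `z` is free on the fibre, so the composite is 0 and divisibility is trivial;
  -- degrees exclude this case later.
  by_cases ht0 : t = 0
  · subst ht0
    have h1 := hrel (lift 0 0 (AdjoinRoot.root q) (by simp)) 0 (by simp) ht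
    rw [lift_cz, AdjoinRoot.aeval_eq, AdjoinRoot.mk_eq_zero] at h1
    exact h1
  · have h1 := hrel (lift (C t) (C t⁻¹ * q) (X : ℂ[X]) (by
      rw [← mul_assoc, ← C_mul, mul_inv_cancel₀ ht0, C_1, one_mul, aeval_X_left_apply])) t
      (by simp) ht
    rw [lift_cz, aeval_X_left_apply] at h1
    rw [h1]
    exact dvd_zero _

/-- Isomorphic surfaces of degree at least two have affinely equivalent defining polynomials. -/
theorem exists_comp_eq_of_monic (hp : p.Monic) (hn : 2 ≤ p.natDegree) (hq : q.Monic)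
    (hpq : q.natDegree = p.natDegree) (φ : CoordRing ℂ p ≃ₐ[ℂ] CoordRing ℂ q) :
    ∃ a b l : ℂ, a ≠ 0 ∧ l ≠ 0 ∧ p.comp (C a * X + C b) = C l * q := by
  obtain ⟨ψ, hψ⟩ := exists_natDegree_eq_zero hp (by omega) hq φ
  obtain ⟨a, b, ha, r, hr⟩ := exists_dvd_comp hp hn hq (by omega) ψ hψ
  have hdeg : (p.comp (C a * X + C b)).natDegree = p.natDegree := by
    rw [natDegree_comp, natDegree_linear ha, mul_one]
  have h0 : p.comp (C a * X + C b) ≠ 0 := by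
    intro h0
    rw [h0, natDegree_zero] at hdeg
    omega
  have hr0 : r ≠ 0 := by
    rintro rfl
    exact h0 (by rw [hr, mul_zero])
  have hrd : r.natDegree = 0 := by
    rw [hr, natDegree_mul hq.ne_zero hr0] at hdeg
    omega
  rw [eq_C_of_natDegree_eq_zero hrd] at hr hr0
  exact ⟨a, b, _, ha, C_ne_zero.mp hr0, hr.trans (mul_comm _ _)⟩

theorem exists_comp_eq (hn : 2 ≤ p.natDegree) (hpq : q.natDegree = p.natDegree)
    (φ : CoordRing ℂ p ≃ₐ[ℂ] CoordRing ℂ q) :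
    ∃ a b l : ℂ, a ≠ 0 ∧ l ≠ 0 ∧ q = C l * p.comp (C a * X + C b) := by
  have hp0 : p.leadingCoeff ≠ 0 := by
    rw [leadingCoeff_ne_zero]
    rintro rfl
    simp at hn
  have hq0 : q.leadingCoeff ≠ 0 := by
    rw [leadingCoeff_ne_zero]
    rintro rfl
    simp at hpq
    omega
  have hc (f : ℂ[X]) : C f.leadingCoeff⁻¹ * f = C f.leadingCoeff⁻¹ * f.comp (C 1 * X + C 0) := by
    simp
  have hd (f : ℂ[X]) (hf : f.leadingCoeff ≠ 0) : (C f.leadingCoeff⁻¹ * f).natDegree = f.natDegree :=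
    natDegree_C_mul (inv_ne_zero hf)
  obtain ⟨a, b, l, ha, hl, h⟩ := exists_comp_eq_of_monic
    (p := C p.leadingCoeff⁻¹ * p) (q := C q.leadingCoeff⁻¹ * q)
    (monic_C_mul_of_mul_leadingCoeff_eq_one (inv_mul_cancel₀ hp0)) (by rwa [hd p hp0])
    (monic_C_mul_of_mul_leadingCoeff_eq_one (inv_mul_cancel₀ hq0)) (by rwa [hd p hp0, hd q hq0])
    ((affineEquiv one_ne_zero (inv_ne_zero hp0) (hc p)).trans
      (φ.trans (affineEquiv one_ne_zero (inv_ne_zero hq0) (hc q)).symm))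
  refine ⟨a, b, l⁻¹ * q.leadingCoeff * p.leadingCoeff⁻¹, ha,
    mul_ne_zero (mul_ne_zero (inv_ne_zero hl) hq0) (inv_ne_zero hp0), ?_⟩
  rw [mul_comp, C_comp] at h
  rw [C_mul, mul_assoc, h, ← mul_assoc, ← mul_assoc, ← C_mul, ← C_mul]
  have : l⁻¹ * q.leadingCoeff * l * q.leadingCoeff⁻¹ = 1 := by field_simp
  rw [this, C_1, one_mul]

end Triangular

/-! ### Polynomials equivalent to their conjugate -/

section RealForm

theorem exists_eq_map_algebraMap {f : ℂ[X]} (hf : ∀ k, starRingEnd ℂ (f.coeff k) = f.coeff k) :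
    ∃ q : ℝ[X], f = q.map (algebraMap ℝ ℂ) := by
  have h : f ∈ lifts (algebraMap ℝ ℂ) := by
    rw [lifts_iff_coeff_lifts]
    exact fun k => (Complex.conj_eq_iff_real.mp (hf k)).imp fun r hr => hr.symm
  obtain ⟨q, hq⟩ := (mem_lifts _).mp h
  exact ⟨q, hq.symm⟩

theorem coeff_comp_X_add_C (p : ℂ[X]) (m : ℂ) (k : ℕ) :
    (p.comp (X + C m)).coeff k = (hasseDeriv k p).eval m :=
  taylor_coeff m p k

theorem coeff_comp_C_mul_X (p : ℂ[X]) (a : ℂ) (k : ℕ) :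
    (p.comp (C a * X)).coeff k = p.coeff k * a ^ k := by
  rw [comp_C_mul_X_coeff]

theorem natDegree_hasseDeriv_natDegree_sub_one {p : ℂ[X]} (hp : p.natDegree ≠ 0) :
    (hasseDeriv (p.natDegree - 1) p).natDegree = 1 := by
  rw [natDegree_hasseDeriv]
  omega

/-- Some translate of a polynomial has vanishing subleading coefficient. -/
theorem exists_comp_coeff_eq_zero {p : ℂ[X]} (hp : p.natDegree ≠ 0) :
    ∃ m : ℂ, (p.comp (X + C m)).coeff (p.natDegree - 1) = 0 := by
  simp only [coeff_comp_X_add_C]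
  have h := natDegree_hasseDeriv_natDegree_sub_one hp
  exact IsAlgClosed.exists_root _ (by
    rw [degree_eq_natDegree (fun h0 => by
      rw [h0, natDegree_zero] at h; exact zero_ne_one h), h]; simp)

/-- As a function of the translation `m`, the subleading coefficient is a polynomial of degree 1,
without constant term when `p` is centred. -/
theorem eq_zero_of_coeff_comp_eq_zero {p : ℂ[X]} (hp : p.natDegree ≠ 0)
    (h0 : p.coeff (p.natDegree - 1) = 0) {m : ℂ}
    (hm : (p.comp (X + C m)).coeff (p.natDegree - 1) = 0) : m = 0 := by
  have h := natDegree_hasseDeriv_natDegree_sub_one hp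
  have h1 : (hasseDeriv (p.natDegree - 1) p).coeff 0 = 0 := by
    rw [hasseDeriv_coeff, zero_add, h0, mul_zero]
  rw [coeff_comp_X_add_C, eval_eq_sum_range, h, Finset.sum_range_succ, Finset.sum_range_one, h1,
    zero_mul, zero_add, pow_one] at hm
  refine (mul_eq_zero.mp hm).resolve_left ?_
  have h2 : (hasseDeriv (p.natDegree - 1) p).leadingCoeff ≠ 0 :=
    leadingCoeff_ne_zero.mpr (fun h0 => by rw [h0, natDegree_zero] at h; exact zero_ne_one h)
  rwa [leadingCoeff, h] at h2

theorem conj_mul_self_of_norm_eq_one {a : ℂ} (ha : ‖a‖ = 1) : starRingEnd ℂ a * a = 1 := by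
  rw [Complex.conj_mul', ha]
  simp

/-- A centred polynomial which is affinely equivalent to its conjugate becomes real after
rescaling. -/
theorem exists_real_rescaling {p : ℂ[X]} (hp : p.natDegree ≠ 0) {s l : ℂ}
    (h : ∀ k, starRingEnd ℂ (p.coeff k) = l * (p.coeff k * s ^ k))
    {j : ℕ} (hj : j < p.natDegree) (hpj : p.coeff j ≠ 0) :
    ∃ a b : ℂ, a ≠ 0 ∧ b ≠ 0 ∧
      ∃ q : ℝ[X], C b * p.comp (C a * X) = q.map (algebraMap ℝ ℂ) := by
  -- Conjugation preserves the modulus. The relation at the two exponents `j` and `deg p` forces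
  -- `‖s‖ = ‖l‖ = 1`.
  have hnorm (k) (hk : p.coeff k ≠ 0) : ‖l‖ * ‖s‖ ^ k = 1 := by
    have h1 := congrArg norm (h k)
    rw [RCLike.norm_conj, norm_mul, norm_mul, norm_pow] at h1
    have h2 : ‖p.coeff k‖ ≠ 0 := norm_ne_zero_iff.mpr hk
    apply mul_left_cancel₀ h2
    linarith
  have hn := hnorm p.natDegree (leadingCoeff_ne_zero.mpr (by rintro rfl; simp at hp))
  have hs : ‖s‖ = 1 := by
    have h1 := hnorm j hpj
    rw [← Nat.add_sub_cancel' hj.le, pow_add, ← mul_assoc, h1, one_mul] at hn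
    exact (pow_eq_one_iff_of_nonneg (norm_nonneg _) (by omega)).mp hn
  have hl : ‖l‖ = 1 := by rwa [hs, one_pow, mul_one] at hn
  -- With `a² = s` and `b² = l` unimodular, the conjugate of `b a ^ k p_k` is `b⁻¹ a ^ (-k) l s ^ k
  -- p_k = b a ^ k p_k`.
  obtain ⟨a, ha⟩ : ∃ a : ℂ, a ^ 2 = s := IsAlgClosed.exists_pow_nat_eq s two_pos
  obtain ⟨b, hb⟩ : ∃ b : ℂ, b ^ 2 = l := IsAlgClosed.exists_pow_nat_eq l two_pos
  have ha1 : ‖a‖ = 1 := by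
    rw [← ha, norm_pow] at hs
    exact (pow_eq_one_iff_of_nonneg (norm_nonneg _) two_ne_zero).mp hs
  have hb1 : ‖b‖ = 1 := by
    rw [← hb, norm_pow] at hl
    exact (pow_eq_one_iff_of_nonneg (norm_nonneg _) two_ne_zero).mp hl
  refine ⟨a, b, by rintro rfl; simp at ha1, by rintro rfl; simp at hb1,
    exists_eq_map_algebraMap fun k => ?_⟩
  have ha2 := conj_mul_self_of_norm_eq_one ha1
  have hb2 := conj_mul_self_of_norm_eq_one hb1
  have ha3 : (starRingEnd ℂ a) ^ k * a ^ k = 1 := by rw [← mul_pow, ha2, one_pow]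
  rw [coeff_C_mul, coeff_comp_C_mul_X, map_mul, map_mul, map_pow, h, ← ha, ← hb, ← pow_mul,
    mul_comm 2 k, pow_mul]
  linear_combination (p.coeff k * b * a ^ k) * (starRingEnd ℂ a ^ k * a ^ k) * hb2 +
    p.coeff k * b * a ^ k * ha3

theorem exists_real_of_forall_coeff_eq_zero {p : ℂ[X]} (hp : p.natDegree ≠ 0)
    (h : ∀ k < p.natDegree, p.coeff k = 0) :
    ∃ a b : ℂ, a ≠ 0 ∧ b ≠ 0 ∧
      ∃ q : ℝ[X], C b * p.comp (C a * X) = q.map (algebraMap ℝ ℂ) := by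
  have h0 : p.leadingCoeff ≠ 0 := leadingCoeff_ne_zero.mpr (by rintro rfl; simp at hp)
  refine ⟨1, p.leadingCoeff⁻¹, one_ne_zero, inv_ne_zero h0,
    exists_eq_map_algebraMap fun k => ?_⟩
  rw [coeff_C_mul, coeff_comp_C_mul_X, one_pow, mul_one]
  rcases lt_trichotomy k p.natDegree with hk | rfl | hk
  · rw [h k hk, mul_zero, map_zero]
  · rw [coeff_natDegree, inv_mul_cancel₀ h0, map_one]
  · rw [coeff_eq_zero_of_natDegree_lt hk, mul_zero, map_zero]

/-- A polynomial which is affinely equivalent to its conjugate is affinely equivalent to a real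
polynomial. -/
theorem exists_real_of_conj_eq {p : ℂ[X]} (hp : p.natDegree ≠ 0)
    (h : 2 ≤ p.natDegree → ∃ a b l : ℂ, a ≠ 0 ∧ l ≠ 0 ∧
      p.map (starRingEnd ℂ) = C l * p.comp (C a * X + C b)) :
    ∃ a l b : ℂ, a ≠ 0 ∧ l ≠ 0 ∧
      ∃ q : ℝ[X], C l * p.comp (C a * X + C b) = q.map (algebraMap ℝ ℂ) := by
  obtain ⟨m, hm⟩ := exists_comp_coeff_eq_zero hp
  obtain ⟨P, hP⟩ : ∃ P, P = p.comp (X + C m) := ⟨_, rfl⟩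
  have hdeg : P.natDegree = p.natDegree := by
    rw [hP, natDegree_comp, natDegree_X_add_C, mul_one]
  rw [← hP, ← hdeg] at hm
  have hP0 : P.natDegree ≠ 0 := hdeg ▸ hp
  suffices hreal : ∃ a b : ℂ, a ≠ 0 ∧ b ≠ 0 ∧
      ∃ q : ℝ[X], C b * P.comp (C a * X) = q.map (algebraMap ℝ ℂ) by
    obtain ⟨a, l, ha, hl, q, hq⟩ := hreal
    refine ⟨a, l, m, ha, hl, q, ?_⟩
    rw [← hq, hP, comp_assoc]
    simp
  by_cases hmon : ∀ k < P.natDegree, P.coeff k = 0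
  · exact exists_real_of_forall_coeff_eq_zero hP0 hmon
  push Not at hmon
  obtain ⟨j, hj, hPj⟩ := hmon
  -- A centred polynomial of degree 1 is a monomial, so the remaining case has degree at least 2.
  have h2 : 2 ≤ p.natDegree := by
    by_contra hlt
    have : j = P.natDegree - 1 := by omega
    exact hPj (this ▸ hm)
  obtain ⟨a, b, l, ha, hl, heq⟩ := h h2
  -- This is the translation left after centring: the conjugate of `P` is `l P(a z + d)`. As it is
  -- centred too, `d = 0`.
  obtain ⟨d, hd⟩ : ∃ d, d = a * starRingEnd ℂ m + b - m := ⟨_, rfl⟩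
  have hCd : C d = C a * C (starRingEnd ℂ m) + C b - C m := by
    rw [hd, C_sub, C_add, C_mul]
  have hconj : P.map (starRingEnd ℂ) = C l * (P.comp (X + C d)).comp (C a * X) := by
    rw [hP, map_comp, heq, mul_comp, C_comp, comp_assoc, comp_assoc, comp_assoc]
    congr 2
    simp only [add_comp, mul_comp, C_comp, X_comp, Polynomial.map_add, map_X, map_C]
    rw [hCd]
    ring
  have hcoeff (k) : starRingEnd ℂ (P.coeff k) = l * ((P.comp (X + C d)).coeff k * a ^ k) := by
    rw [← coeff_comp_C_mul_X, ← coeff_C_mul, ← hconj, coeff_map]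
  have hd0 : d = 0 := by
    refine eq_zero_of_coeff_comp_eq_zero hP0 hm ?_
    have h1 := hcoeff (P.natDegree - 1)
    rw [hm, map_zero, eq_comm, mul_eq_zero, mul_eq_zero] at h1
    exact (h1.resolve_left hl).resolve_right (pow_ne_zero _ ha)
  subst hd0
  exact exists_real_rescaling hP0 (s := a) (l := l) (by simpa using hcoeff) hj hPj

end RealForm

end Danielewski
end

theorem mainTheorem4 (p : ℂ[X]) (hp : p.natDegree ≠ 0) :
    List.TFAE [
      Nonempty (Danielewski.RealStructure (Danielewski.surface ℂ p)),
      ∃ a l b : ℂ, a ≠ 0 ∧ l ≠ 0 ∧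
        ∃ q : ℝ[X], C l * p.comp (C a * X + C b) = q.map (algebraMap ℝ ℂ),
      ∃ q : ℝ[X], Nonempty
        (Danielewski.surface ℂ p ≅ Danielewski.surface ℂ (q.map (algebraMap ℝ ℂ)))] := by
  tfae_have 1 → 2 := by
    rintro ⟨R⟩
    obtain ⟨φ⟩ := R.exists_algEquiv
    exact Danielewski.exists_real_of_conj_eq hp fun h2 =>
      Danielewski.exists_comp_eq h2 (natDegree_map _) φ
  tfae_have 2 → 3 := by
    rintro ⟨a, l, b, ha, hl, q, hq⟩
    exact ⟨q, Danielewski.nonempty_surface_iso (Danielewski.affineEquiv ha hl hq.symm).symm⟩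
  tfae_have 3 → 1 := by
    rintro ⟨q, ⟨e⟩⟩
    have hq : (q.map (algebraMap ℝ ℂ)).map (starRingEnd ℂ) = q.map (algebraMap ℝ ℂ) := by
      rw [Polynomial.map_map]
      congr 1
      ext r
      exact Complex.conj_ofReal r
    obtain ⟨R⟩ := Danielewski.nonempty_realStructure_of_conj_eq hq
    exact Danielewski.RealStructure.of_iso e R
  tfae_finish
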